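/- **Proposition 2.1 (combinatorial vs geometric boundary).** Let $k\ge 0$ and let $X$ be a finite regular CW complex of dimension exactly $k$: it has finitely many cells, it has a $k$-cell and no cell of larger dimension, and every characteristic map is a homeomorphism of a closed ball onto its image (so in particular every gluing map is a homeomorphism onto its image). No metric condition is required; in particular $X$ may be any such complex whose gluing maps are isometries for chosen metrics on its cells. For a topological embedding $f\colon X\hookrightarrow\mathbb R^k$, let the *geometric boundary* of $X$ with respect to $f$ be the set of points $p\in X$ such that every neighbourhood of $f(p)$ in $\mathbb R^k$ meets both $f(X)$ and $\mathbb R^k\setminus f(X)$. Let the *combinatorial boundary* of $X$ be the union of all closed cells in the downward closure (with respect to containment of closed cells) of the set of those cells of dimension less than $k$ that are contained in at most one $k$-cell. Then for every topological embedding $f\colon X\hookrightarrow\mathbb R^k$, the geometric boundary of $X$ with respect to $f$ equals the combinatorial boundary of $X$. In particular, the geometric boundary does not depend on the embedding: any two topological embeddings $f,g\colon X\hookrightarrow\mathbb R^k$ give the same subset of $X$. -/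

import Mathlib

open Set Metric Topology

namespace RegularCW

/-- `X` is a *regular* CW complex: each characteristic map restricts to a homeomorphism from the
closed ball (here the cube `[-1, 1]ⁿ`) onto its image, so that in particular each gluing map,
its restriction to the boundary sphere, is a homeomorphism onto its image. -/
def IsRegular (X : Type*) [TopologicalSpace X] [CWComplex (univ : Set X)] : Prop :=
  ∀ (n : ℕ) (e : RelCWComplex.cell (univ : Set X) n),
    IsEmbedding ((closedBall (0 : Fin n → ℝ) 1).domRestrict (RelCWComplex.map n e))

/-- `X` has dimension exactly `k`: there is a cell of dimension `k`, and none of larger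
dimension. -/
def HasDimension (X : Type*) [TopologicalSpace X] [CWComplex (univ : Set X)] (k : ℕ) : Prop :=
  Nonempty (RelCWComplex.cell (univ : Set X) k) ∧
    ∀ m : ℕ, k < m → IsEmpty (RelCWComplex.cell (univ : Set X) m)

/-- A cell of a CW complex: its dimension together with its index. -/
abbrev Cell (X : Type*) [TopologicalSpace X] [CWComplex (univ : Set X)] : Type _ :=
  Σ n : ℕ, RelCWComplex.cell (univ : Set X) n

/-- The set of points of a (closed) cell. -/
def Cell.carrier {X : Type*} [TopologicalSpace X] [CWComplex (univ : Set X)] (c : Cell X) :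
    Set X :=
  RelCWComplex.closedCell c.1 c.2

/-- The cells of dimension less than `k` that are contained in at most one cell of
dimension `k`. -/
def freeCells (X : Type*) [TopologicalSpace X] [CWComplex (univ : Set X)] (k : ℕ) :
    Set (Cell X) :=
  {c | c.1 < k ∧ {T : Cell X | T.1 = k ∧ c.carrier ⊆ T.carrier}.Subsingleton}

/-- The downward closure of a set of cells: all cells contained in some cell of the set. -/
def downwardClosure {X : Type*} [TopologicalSpace X] [CWComplex (univ : Set X)]
    (S : Set (Cell X)) : Set (Cell X) :=
  {c | ∃ d ∈ S, c.carrier ⊆ d.carrier}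

/-- The combinatorial boundary of a `k`-dimensional CW complex, as a set of points: the union of
the cells in the downward closure of the cells of dimension less than `k` that lie in at most one
`k`-cell. -/
def combinatorialBoundary (X : Type*) [TopologicalSpace X] [CWComplex (univ : Set X)] (k : ℕ) :
    Set X :=
  ⋃ c ∈ downwardClosure (freeCells X k), c.carrier

/-- The geometric boundary of `X` with respect to a map `f : X → ℝᵏ`: the points `p` of `X` such
that each neighbourhood of `f p` in `ℝᵏ` meets both the image of `X` and its complement. -/
def geometricBoundary {X : Type*} {k : ℕ} (f : X → EuclideanSpace ℝ (Fin k)) : Set X :=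
  {p | ∀ U ∈ 𝓝 (f p), (U ∩ range f).Nonempty ∧ (U ∩ (range f)ᶜ).Nonempty}

end RegularCW

/-! A point is off the geometric boundary exactly when its image is interior to `range f`. Write $k$
for the top dimension. The proof rests on three facts in $\mathbb R^k$: invariance of domain;
finitely many compact sets of dimension less than $k$ cannot cover a nonempty open set; finitely
many of dimension less than $k-1$ cannot separate a convex set. All three come from Brouwer's fixed
point theorem, the last two by perturbing a map off "thin" sets.

Suppose $p$ is in the open cell of $c$, $\dim c<k$, and $f(p)$ is interior. Only cells containing
$p$ matter near $f(p)$, and by regularity these contain $c$. If only one $k$-cell $T$ were among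
them, then by the covering fact a neighbourhood of $f(p)$ would lie in $f(T)$; read in the ball of
$T$, invariance of domain would put $p$ in the open cell of $T$, against disjointness of open cells
(`not_subsingleton_of_mem_interior`).

Conversely, let every cell of dimension less than $k$ containing $p$ lie in two $k$-cells. Near
$f(p)$, open $k$-cells map to interior points, and so do open $(k-1)$-cells, where two $k$-cells are
glued together (`image_inner_subset_interior`). Only cells of codimension at least two remain. If
$f(p)$ were not interior, they would separate a small ball into the interior of the image and its
complement (`mem_interior_of_forall_not_subsingleton`). -/

/-! ### Brouwer's fixed point theorem by the Milnor–Rogers volume argument, and variational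
inequalities. -/

section Brouwer

open MeasureTheory RealInnerProductSpace

variable {E : Type*} [NormedAddCommGroup E] [InnerProductSpace ℝ E]

/-- The nearest-point projection onto a compact convex set, with its variational
characterization. -/
theorem exists_nearestPoint_projection {C : Set E} (hne : C.Nonempty) (hC : IsCompact C)
    (hconv : Convex ℝ C) :
    ∃ π : E → E, LipschitzWith 1 π ∧ (∀ x, π x ∈ C) ∧
      ∀ x, ∀ y ∈ C, ⟪x - π x, y - π x⟫ ≤ 0 := by
  choose π hπ hmin using exists_norm_eq_iInf_of_complete_convex hne hC.isComplete hconv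
  have hvar : ∀ x, ∀ y ∈ C, ⟪x - π x, y - π x⟫ ≤ 0 := fun x ↦
    (norm_eq_iInf_iff_real_inner_le_zero hconv (hπ x)).1 (hmin x)
  refine ⟨π, LipschitzWith.of_dist_le_mul fun x y ↦ ?_, hπ, hvar⟩
  have h1 := hvar x _ (hπ y)
  have h2 := hvar y _ (hπ x)
  have h3 : ⟪π x - π y, π x - π y⟫ ≤ ⟪x - y, π x - π y⟫ := by
    have e : ⟪x - y, π x - π y⟫ - ⟪π x - π y, π x - π y⟫ =
        -⟪x - π x, π y - π x⟫ - ⟪y - π y, π x - π y⟫ := by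
      simp only [inner_sub_left, inner_sub_right]; ring
    linarith
  rw [NNReal.coe_one, one_mul, dist_eq_norm, dist_eq_norm]
  rw [real_inner_self_eq_norm_sq] at h3
  have h4 := real_inner_le_norm (x - y) (π x - π y)
  by_contra! hlt
  have : 0 < ‖π x - π y‖ := (norm_nonneg _).trans_lt hlt
  nlinarith

theorem exists_pos_det_pos [CompleteSpace E] :
    ∃ δ > 0, ∀ A : E →L[ℝ] E, ‖A‖ < δ → 0 < (1 + A : E →L[ℝ] E).det := by
  have hc : Continuous fun A : E →L[ℝ] E ↦ (1 + A : E →L[ℝ] E).det :=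
    (ContinuousLinearMap.continuous_det (𝕜 := ℝ)).comp (continuous_const.add continuous_id)
  have h0 : (0 : ℝ) < (1 + (0 : E →L[ℝ] E)).det := by
    simp [ContinuousLinearMap.det]
  obtain ⟨δ, hδ, h⟩ := Metric.mem_nhds_iff.1 (hc.continuousAt.eventually (lt_mem_nhds h0))
  exact ⟨δ, hδ, fun A hA ↦ h (by simpa using hA)⟩

variable [FiniteDimensional ℝ E]

/-- The determinant of `1 + t A` is a polynomial of degree at most the dimension in `t`. -/
theorem exists_polynomial_det_one_add_smul (A : E →L[ℝ] E) :
    ∃ p : Polynomial ℝ, p.natDegree ≤ Module.finrank ℝ E ∧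
      ∀ t : ℝ, p.eval t = (1 + t • A : E →L[ℝ] E).det := by
  let b := Module.finBasis ℝ E
  let M := LinearMap.toMatrix b b A
  let I : Matrix (Fin (Module.finrank ℝ E)) (Fin (Module.finrank ℝ E)) ℝ := 1
  refine ⟨((Polynomial.X : Polynomial ℝ) • M.map Polynomial.C + I.map Polynomial.C).det, ?_, ?_⟩
  · simpa using Polynomial.natDegree_det_X_add_C_le M I
  · intro t
    rw [← Polynomial.coe_evalRingHom, RingHom.map_det, ContinuousLinearMap.det,
      ← LinearMap.det_toMatrix b]
    congr 1
    ext i j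
    simp [M, I, Matrix.add_apply, Matrix.one_apply, add_comm, apply_ite (Polynomial.eval t),
      mul_comm t]

/-- A Lipschitz perturbation of the identity supported in a set maps this set onto itself. -/
theorem image_add_lipschitz_eq_self {G : E → E} {K : NNReal} (hG : LipschitzWith K G) (hK : K < 1)
    {s : Set E} (hs : ∀ x ∉ s, G x = 0) :
    (fun x ↦ x + G x).Injective ∧ (fun x ↦ x + G x) '' s = s := by
  have hinj : (fun x ↦ x + G x).Injective := by
    intro x y hxy
    have h1 : x - y = G y - G x := by
      have : x + G x = y + G y := hxy
      rw [sub_eq_sub_iff_add_eq_add, this, add_comm]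
    have h2 := hG.dist_le_mul y x
    rw [dist_eq_norm, ← h1, dist_comm, dist_eq_norm] at h2
    have hK' : (K : ℝ) < 1 := hK
    have : ‖x - y‖ = 0 := by nlinarith [norm_nonneg (x - y)]
    exact sub_eq_zero.1 (norm_eq_zero.1 this)
  refine ⟨hinj, Subset.antisymm ?_ ?_⟩
  · rintro _ ⟨x, hx, rfl⟩
    by_contra hns
    have := hs _ hns
    have h2 : (fun x ↦ x + G x) (x + G x) = x + G x := by simp only [this, add_zero]
    have h3 : x + G x = x := hinj h2
    exact hns (by simpa only [h3] using hx)
  · intro y hy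
    have hcon : ContractingWith K fun x ↦ y - G x := by
      refine ⟨hK, LipschitzWith.of_dist_le_mul fun a b ↦ ?_⟩
      rw [dist_sub_left]
      exact hG.dist_le_mul a b
    have hfix := hcon.fixedPoint_isFixedPt
    set x := ContractingWith.fixedPoint _ hcon
    have hfix' : y - G x = x := hfix
    have hx : x + G x = y := by rw [← sub_eq_iff_eq_add.1 hfix']
    refine ⟨x, ?_, hx⟩
    by_contra hxs
    rw [hs x hxs, add_zero] at hx
    exact hxs (hx ▸ hy)

/-- There is no `C¹` retraction of the closed unit ball onto the unit sphere. -/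
theorem not_exists_contDiffOn_retraction {r : E → E} (hr : ContDiffOn ℝ 1 r (closedBall 0 1))
    (hsph : ∀ x ∈ closedBall (0 : E) 1, ‖r x‖ = 1) (hid : ∀ x ∈ sphere (0 : E) 1, r x = x) :
    False := by
  borelize E
  set B : Set E := ball 0 1
  set g : E → E := fun x ↦ r x - x
  have hg : ContDiffOn ℝ 1 g (closedBall 0 1) := hr.sub contDiffOn_id
  obtain ⟨K, hK⟩ := hg.exists_lipschitzOnWith one_ne_zero (convex_closedBall _ _)
    (isCompact_closedBall _ _)
  obtain ⟨π, hπ, hπC, hπv⟩ := exists_nearestPoint_projection (C := closedBall (0 : E) 1)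
    ⟨0, by simp⟩ (isCompact_closedBall _ _) (convex_closedBall _ _)
  have hπid : ∀ x ∈ closedBall (0 : E) 1, π x = x := fun x hx ↦ by
    have := hπv x x hx
    rw [real_inner_self_eq_norm_sq] at this
    have h0 : ‖x - π x‖ = 0 := by nlinarith [norm_nonneg (x - π x)]
    exact (sub_eq_zero.1 (norm_eq_zero.1 h0)).symm
  -- If `π x` were inside the open ball, a short move towards `x` would stay in the ball, and the
  -- variational inequality would force `π x = x`.
  have hπs : ∀ x ∉ B, ‖π x‖ = 1 := fun x hx ↦ by
    have h1 : ‖π x‖ ≤ 1 := by simpa using hπC x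
    refine h1.antisymm (not_lt.1 fun hlt ↦ ?_)
    have hc : Continuous fun t : ℝ ↦ ‖π x + t • (x - π x)‖ := by fun_prop
    have h2 : ∀ᶠ t in 𝓝[>] (0 : ℝ), ‖π x + t • (x - π x)‖ < 1 :=
      (hc.tendsto 0).eventually (gt_mem_nhds (by simpa using hlt)) |>.filter_mono nhdsWithin_le_nhds
    obtain ⟨t, ht, ht0⟩ := (h2.and self_mem_nhdsWithin).exists
    have h3 := hπv x (π x + t • (x - π x)) (by simpa using ht.le)
    rw [add_sub_cancel_left, inner_smul_right, real_inner_self_eq_norm_sq] at h3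
    have h4 : ‖x - π x‖ ^ 2 ≤ 0 := by
      by_contra! hpos
      exact absurd (mul_pos ht0 hpos) (not_lt.2 h3)
    have h5 : ‖x - π x‖ = 0 := by nlinarith [norm_nonneg (x - π x)]
    rw [← sub_eq_zero.1 (norm_eq_zero.1 h5)] at hlt
    exact hx (by simpa [B] using hlt)
  -- `π` sends the complement of `B` to the sphere, where `g` vanishes, so `G` extends `g` by zero
  -- with the same Lipschitz constant.
  set G : E → E := fun x ↦ g (π x)
  have hG : LipschitzWith K G := LipschitzWith.of_dist_le_mul fun x y ↦
    (hK.dist_le_mul _ (hπC x) _ (hπC y)).trans <| by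
      gcongr
      simpa using hπ.dist_le_mul x y
  have hG0 : ∀ x ∉ B, G x = 0 := fun x hx ↦ by
    simp only [G, g]
    rw [hid _ (by simpa using hπs x hx), sub_self]
  set g' : E → E →L[ℝ] E := fun x ↦ fderiv ℝ g x
  have hBn : ∀ x ∈ B, closedBall (0 : E) 1 ∈ 𝓝 x := fun x hx ↦
    Filter.mem_of_superset (isOpen_ball.mem_nhds hx) ball_subset_closedBall
  have hg' : ∀ x ∈ B, HasFDerivAt g (g' x) x := fun x hx ↦
    ((hg.contDiffAt (hBn x hx)).differentiableAt one_ne_zero).hasFDerivAt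
  have hg'K : ∀ x ∈ B, ‖g' x‖ ≤ K := fun x hx ↦ norm_fderiv_le_of_lipschitzOn ℝ (hBn x hx) hK
  choose p hpdeg hpeval using fun x ↦ exists_polynomial_det_one_add_smul (g' x)
  obtain ⟨δ, hδ, hdet⟩ := exists_pos_det_pos (E := E)
  -- for small `t`, the perturbation `id + t g` is a bijection of the ball
  set ε : ℝ := min 1 δ / (K + 1) / 2
  have hε : 0 < ε := by positivity
  have hεK : ε * K < min 1 δ := by
    have : ε * (K + 1) = min 1 δ / 2 := by simp only [ε]; field_simp
    have : 0 < min 1 δ := by positivity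
    nlinarith
  have hsmall : ∀ t ∈ Icc 0 ε, IntegrableOn (fun x ↦ (p x).eval t) B volume ∧
      ∫ x in B, (p x).eval t = volume.real B := by
    intro t ht
    have htK : t * K < min 1 δ := (mul_le_mul_of_nonneg_right ht.2 K.2).trans_lt hεK
    have hlip : LipschitzWith (t.toNNReal * K) fun x ↦ t • G x :=
      LipschitzWith.of_dist_le_mul fun x y ↦ by
        rw [dist_smul₀, Real.norm_of_nonneg ht.1, NNReal.coe_mul, mul_assoc,
          Real.coe_toNNReal _ ht.1]
        exact mul_le_mul_of_nonneg_left (hG.dist_le_mul x y) ht.1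
    obtain ⟨hinj, him⟩ := image_add_lipschitz_eq_self hlip
      (by
        rw [← NNReal.coe_lt_coe, NNReal.coe_mul, Real.coe_toNNReal _ ht.1]
        exact htK.trans_le (min_le_left _ _)) (s := B)
      (fun x hx ↦ by rw [hG0 x hx, smul_zero])
    have hder : ∀ x ∈ B, HasFDerivWithinAt (fun x ↦ x + t • G x) (1 + t • g' x) B x := by
      intro x hx
      have h1 : HasFDerivAt (fun x ↦ x + t • g x) (1 + t • g' x) x :=
        (hasFDerivAt_id x).add ((hg' x hx).const_smul t)
      exact h1.hasFDerivWithinAt.congr'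
        (fun y hy ↦ by simp only [G, hπid y (ball_subset_closedBall hy)]) hx
    -- The determinant is positive for small `t`, so the Jacobian is itself a polynomial in `t`.
    have habs : ∀ x ∈ B, |(1 + t • g' x).det| • (1 : ℝ) = (p x).eval t := fun x hx ↦ by
      rw [hpeval, abs_of_pos, smul_eq_mul, mul_one]
      refine hdet _ ?_
      rw [norm_smul, Real.norm_of_nonneg ht.1]
      exact (mul_le_mul_of_nonneg_left (hg'K x hx) ht.1).trans_lt (htK.trans_le (min_le_right _ _))
    have hi1 := integrableOn_image_iff_integrableOn_abs_det_fderiv_smul volume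
      measurableSet_ball hder hinj.injOn (fun _ ↦ (1 : ℝ))
    have hi2 := integral_image_eq_integral_abs_det_fderiv_smul volume
      measurableSet_ball hder hinj.injOn (fun _ ↦ (1 : ℝ))
    rw [him] at hi1 hi2
    rw [integrableOn_congr_fun habs measurableSet_ball] at hi1
    rw [setIntegral_congr_fun measurableSet_ball habs] at hi2
    refine ⟨hi1.1 (integrableOn_const measure_ball_lt_top.ne), hi2.symm.trans ?_⟩
    simp [Measure.real]
  set n := Module.finrank ℝ E
  set v : ℕ → ℝ := fun i ↦ ε * (i / (n + 1))
  have hvinj : InjOn v (Finset.range (n + 1) : Set ℕ) := fun i _ j _ hij ↦ by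
    have hn : (n : ℝ) + 1 ≠ 0 := by positivity
    simp only [v] at hij
    field_simp at hij
    exact_mod_cast hij
  have hvmem : ∀ i ∈ Finset.range (n + 1), v i ∈ Icc 0 ε := fun i hi ↦ by
    have : (i : ℝ) ≤ n + 1 := by exact_mod_cast (Finset.mem_range.1 hi).le
    refine ⟨by positivity, mul_le_of_le_one_right hε.le ?_⟩
    exact div_le_one_of_le₀ this (by positivity)
  -- Interpolation at `n + 1` nodes in `[0, ε]` writes the value at `1` as a fixed linear
  -- combination of values at small `t`, so the volume identity carries over to `t = 1`.
  have hlag : ∀ q : Polynomial ℝ, q.natDegree ≤ n → q.eval 1 = ∑ i ∈ Finset.range (n + 1),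
      q.eval (v i) * (Lagrange.basis (Finset.range (n + 1)) v i).eval 1 := fun q hq ↦ by
    conv_lhs => rw [Lagrange.eq_interpolate (f := q) hvinj (by
      rw [Finset.card_range]
      exact (Polynomial.degree_le_of_natDegree_le hq).trans_lt (by exact_mod_cast n.lt_succ_self))]
    simp [Lagrange.interpolate_apply, Polynomial.eval_finsetSum]
  have hone : ∫ x in B, (p x).eval 1 = volume.real B := by
    simp_rw [fun x ↦ hlag (p x) (hpdeg x)]
    rw [integral_finsetSum _ fun i hi ↦ ((hsmall _ (hvmem i hi)).1.mul_const _)]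
    simp_rw [integral_mul_const]
    rw [Finset.sum_congr rfl fun i hi ↦ by rw [(hsmall _ (hvmem i hi)).2], ← Finset.mul_sum]
    have := hlag 1 (by simp)
    simp only [Polynomial.eval_one, one_mul] at this
    rw [← this, mul_one]
  -- At `t = 1` this is the Jacobian of `r`. Were it invertible, some direction `w` would be sent to
  -- `r x`, and differentiating `⟪r, r⟫ = 1` along `w` would give `2 = 0`.
  have hzero : ∀ x ∈ B, (p x).eval 1 = 0 := by
    intro x hx
    rw [hpeval, one_smul]
    by_contra hne
    have hrd : HasFDerivAt r (1 + g' x) x := by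
      have := (hasFDerivAt_id (𝕜 := ℝ) x).add (hg' x hx)
      refine this.congr_of_eventuallyEq (.of_forall fun y ↦ ?_)
      simp [g]
    have hconst : (fun y ↦ ⟪r y, r y⟫) =ᶠ[𝓝 x] fun _ ↦ 1 := by
      filter_upwards [hBn x hx] with y hy
      rw [real_inner_self_eq_norm_sq, hsph y hy, one_pow]
    have hd := (hrd.inner ℝ hrd).unique
      ((hasFDerivAt_const (1 : ℝ) x).congr_of_eventuallyEq hconst)
    have hsurj : Function.Surjective (1 + g' x : E →L[ℝ] E) := by
      exact (LinearMap.equivOfDetNeZero ((1 + g' x : E →L[ℝ] E) : E →ₗ[ℝ] E) hne).surjective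
    obtain ⟨w, hw⟩ := hsurj (r x)
    have h1 := congrArg (fun L : E →L[ℝ] ℝ ↦ L w) hd
    have h2 : ⟪r x, r x⟫ = 1 := by
      rw [real_inner_self_eq_norm_sq, hsph x (ball_subset_closedBall hx), one_pow]
    simp only [ContinuousLinearMap.comp_apply, fderivInnerCLM_apply,
      ContinuousLinearMap.prod_apply, hw, h2, zero_apply] at h1
    norm_num at h1
  have hpos : 0 < volume.real B :=
    ENNReal.toReal_pos (measure_ball_pos _ _ one_pos).ne' measure_ball_lt_top.ne
  rw [setIntegral_congr_fun measurableSet_ball hzero] at hone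
  simp at hone
  exact hpos.ne hone

/-- Without a fixed point, the ray from `F x` through `x` leaves the ball at `x + c x • u x`, with
`c x` the larger root of a quadratic. Its discriminant `d` is positive on the whole closed ball, so
this is a `C¹` retraction onto the sphere. -/
theorem exists_fixedPoint_of_contDiff {F : E → E} (hF : ContDiff ℝ 1 F)
    (hmaps : MapsTo F (closedBall 0 1) (closedBall 0 1)) :
    ∃ x ∈ closedBall (0 : E) 1, F x = x := by
  by_contra! hne
  set u : E → E := fun x ↦ x - F x
  have hu : ContDiff ℝ 1 u := contDiff_id.sub hF
  have hu0 : ∀ x ∈ closedBall (0 : E) 1, 0 < ‖u x‖ ^ 2 := fun x hx ↦ by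
    have : u x ≠ 0 := sub_ne_zero.2 (hne x hx).symm
    positivity
  have hb : ∀ x, ⟪x, u x⟫ = (‖u x‖ ^ 2 + ‖x‖ ^ 2 - ‖F x‖ ^ 2) / 2 := fun x ↦ by
    simp only [u, inner_sub_right, ← real_inner_self_eq_norm_sq, inner_sub_left,
      real_inner_comm x (F x)]
    ring
  set d : E → ℝ := fun x ↦ ⟪x, u x⟫ ^ 2 + ‖u x‖ ^ 2 * (1 - ‖x‖ ^ 2)
  have hsphere : ∀ x ∈ sphere (0 : E) 1, 0 < ⟪x, u x⟫ := fun x hx ↦ by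
    have h1 : ‖x‖ = 1 := by simpa using hx
    have h2 : ‖F x‖ ≤ 1 := by simpa using hmaps (sphere_subset_closedBall hx)
    have h3 := hu0 x (sphere_subset_closedBall hx)
    rw [hb, h1]
    nlinarith [norm_nonneg (F x)]
  have hd : ∀ x ∈ closedBall (0 : E) 1, 0 < d x := fun x hx ↦ by
    have h1 : ‖x‖ ≤ 1 := by simpa using hx
    rcases h1.lt_or_eq with h | h
    · have : 0 < ‖u x‖ ^ 2 * (1 - ‖x‖ ^ 2) :=
        mul_pos (hu0 x hx) (by nlinarith [norm_nonneg x])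
      positivity
    · have := hsphere x (by simpa using h)
      simp only [d, h]
      nlinarith
  have hdc : ContDiff ℝ 1 d :=
    ((contDiff_id.inner ℝ hu).pow 2).add
      ((hu.norm_sq ℝ).mul (contDiff_const.sub (contDiff_id.norm_sq ℝ)))
  set c : E → ℝ := fun x ↦ (-⟪x, u x⟫ + √(d x)) / ‖u x‖ ^ 2
  refine not_exists_contDiffOn_retraction (r := fun x ↦ x + c x • u x) ?_ ?_ ?_
  · refine contDiffOn_id.add (ContDiffOn.smul (ContDiffOn.div ?_ (hu.norm_sq ℝ).contDiffOn ?_)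
      hu.contDiffOn)
    · exact (contDiff_id.inner ℝ hu).neg.contDiffOn.add
        (hdc.contDiffOn.sqrt fun x hx ↦ (hd x hx).ne')
    · exact fun x hx ↦ (hu0 x hx).ne'
  · intro x hx
    have ha : ‖u x‖ ≠ 0 := fun h ↦ by simpa [h] using hu0 x hx
    have hs := Real.sq_sqrt (hd x hx).le
    have key : ‖x + c x • u x‖ ^ 2 = 1 := by
      rw [norm_add_sq_real, inner_smul_right, norm_smul, mul_pow, Real.norm_eq_abs, sq_abs]
      simp only [c]
      field_simp
      simp only [d] at hs ⊢
      linear_combination hs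
    have h0 := norm_nonneg (x + c x • u x)
    nlinarith
  · intro x hx
    have h1 : ‖x‖ = 1 := by simpa using hx
    have : c x = 0 := by
      simp only [c, d, h1]
      rw [one_pow, sub_self, mul_zero, add_zero, Real.sqrt_sq (hsphere x hx).le,
        neg_add_cancel, zero_div]
    rw [this, zero_smul, add_zero]

/-- **Brouwer's fixed point theorem** for the closed unit ball. -/
theorem exists_fixedPoint_closedBall {F : E → E} (hF : Continuous F)
    (hmaps : MapsTo F (closedBall 0 1) (closedBall 0 1)) :
    ∃ x ∈ closedBall (0 : E) 1, F x = x := by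
  by_contra! hne
  obtain ⟨x₀, hx₀, hmin⟩ := (isCompact_closedBall (0 : E) 1).exists_isMinOn ⟨0, by simp⟩
    (f := fun x ↦ ‖F x - x‖) (by fun_prop)
  have hpos : 0 < ‖F x₀ - x₀‖ := norm_pos_iff.2 (sub_ne_zero.2 (hne x₀ hx₀))
  -- `(1 + ε)⁻¹ • P` preserves the ball, and its fixed point is moved by `F` at most `2 * ε`, less
  -- than the minimal displacement `3 * ε`.
  set ε : ℝ := ‖F x₀ - x₀‖ / 3
  have hε : 0 < ε := by positivity
  obtain ⟨P, hP, hPF, -⟩ := hF.exists_contDiff_approx 1 (ε := fun _ ↦ ε) continuous_const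
    fun _ ↦ hε
  have hPn : ∀ x ∈ closedBall (0 : E) 1, ‖P x‖ ≤ 1 + ε := fun x hx ↦ by
    have h1 : ‖F x‖ ≤ 1 := by simpa using hmaps hx
    have h2 := hPF x
    rw [dist_eq_norm] at h2
    have h3 := norm_add_le (F x) (P x - F x)
    rw [add_sub_cancel] at h3
    linarith
  obtain ⟨x, hx, hfix⟩ := exists_fixedPoint_of_contDiff (F := fun x ↦ (1 + ε)⁻¹ • P x)
    ((contDiff_const (c := (1 + ε)⁻¹)).smul hP) fun x hx ↦ by
      rw [mem_closedBall_zero_iff, norm_smul, Real.norm_of_nonneg (by positivity)]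
      exact inv_mul_le_one_of_le₀ (hPn x hx) (by positivity)
  have h1 : P x = (1 + ε) • x := by
    conv_rhs => rw [← hfix]
    rw [smul_inv_smul₀ (by positivity)]
  have h2 := hPF x
  have h3 : ‖F x₀ - x₀‖ ≤ ‖F x - x‖ := hmin hx
  have h4 : F x - x = ε • x - (P x - F x) := by rw [h1]; module
  have h5 := norm_sub_le (ε • x) (P x - F x)
  rw [← h4, norm_smul, Real.norm_of_nonneg hε.le] at h5
  rw [dist_eq_norm] at h2
  have h6 : ‖x‖ ≤ 1 := by simpa using hx
  have h7 : ‖F x₀ - x₀‖ = 3 * ε := by simp only [ε]; ring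
  nlinarith

/-- The **Hartman–Stampacchia theorem**: a continuous vector field on a compact convex set solves
its variational inequality. -/
theorem exists_forall_inner_nonneg {C : Set E} (hne : C.Nonempty) (hC : IsCompact C)
    (hconv : Convex ℝ C) {D : E → E} (hD : ContinuousOn D C) :
    ∃ x ∈ C, ∀ y ∈ C, 0 ≤ ⟪D x, y - x⟫ := by
  obtain ⟨π, hπ, hπC, hπv⟩ := exists_nearestPoint_projection hne hC hconv
  obtain ⟨R, hR, hCR⟩ := hC.isBounded.exists_pos_norm_le
  have hDπ : Continuous fun x ↦ D (π x) := hD.comp_continuous hπ.continuous hπC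
  -- A point with `z = π (z - D z)` solves the inequality. The inner `π` keeps `D` evaluated on `C`,
  -- and the factor `R` rescales `C` into the unit ball.
  obtain ⟨y, -, hy⟩ := exists_fixedPoint_closedBall
    (F := fun y ↦ R⁻¹ • π (π (R • y) - D (π (R • y))))
    (by
      have h1 : Continuous fun y : E ↦ D (π (R • y)) := hDπ.comp (continuous_const_smul R)
      have h2 : Continuous fun y : E ↦ π (R • y) := hπ.continuous.comp (continuous_const_smul R)
      exact (hπ.continuous.comp (h2.sub h1)).const_smul _)
    (fun y _ ↦ by
      rw [mem_closedBall_zero_iff, norm_smul, Real.norm_of_nonneg (by positivity)]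
      exact inv_mul_le_one_of_le₀ (hCR _ (hπC _)) hR.le)
  set z := π (π (R • y) - D (π (R • y)))
  have hz : R • y = z := by rw [← hy, smul_inv_smul₀ hR.ne']
  have hzC : z ∈ C := hπC _
  have hπz : π z = z := by
    have := hπv z z hzC
    rw [real_inner_self_eq_norm_sq] at this
    have h0 : ‖z - π z‖ = 0 := by nlinarith [norm_nonneg (z - π z)]
    exact (sub_eq_zero.1 (norm_eq_zero.1 h0)).symm
  have hzz : π (z - D z) = z := by
    have : z = π (π (R • y) - D (π (R • y))) := rfl
    rw [hz, hπz] at this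
    exact this.symm
  refine ⟨z, hzC, fun w hw ↦ ?_⟩
  have := hπv (z - D z) w hw
  rw [hzz, sub_sub_cancel_left, inner_neg_left] at this
  linarith

end Brouwer

/-! ### Perturbation off thin sets, non-separation in codimension two, invariance of domain. -/

section InvarianceOfDomain

open MeasureTheory RealInnerProductSpace

/-- A compact set that embeds into Euclidean space of dimension `d`. -/
def EmbedsInDim {X : Type*} [TopologicalSpace X] (d : ℕ) (K : Set X) : Prop :=
  IsCompact K ∧ ∃ j : X → EuclideanSpace ℝ (Fin d), ContinuousOn j K ∧ InjOn j K

/-- A compact set with an embedding into `W` whose image remains nowhere dense under all `C¹`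
maps. -/
def IsThin {X : Type*} [TopologicalSpace X] (W : Type*) [NormedAddCommGroup W] [NormedSpace ℝ W]
    (K : Set X) : Prop :=
  IsCompact K ∧ ∃ j : X → W, ContinuousOn j K ∧ InjOn j K ∧
    ∀ g : W → W, ContDiff ℝ 1 g → Dense (g '' (j '' K))ᶜ

theorem dense_compl_image_of_null {W : Type*} [NormedAddCommGroup W] [NormedSpace ℝ W]
    [FiniteDimensional ℝ W] [MeasurableSpace W] [BorelSpace W] (μ : Measure W)
    [μ.IsAddHaarMeasure] {S : Set W} (hS : μ S = 0) {g : W → W} (hg : ContDiff ℝ 1 g) :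
    Dense (g '' S)ᶜ := by
  rw [← interior_eq_empty_iff_dense_compl]
  by_contra hne
  have := isOpen_interior.measure_pos μ (nonempty_iff_ne_empty.2 hne)
  exact this.ne' (measure_mono_null interior_subset
    (addHaar_image_eq_zero_of_differentiableOn_of_addHaar_eq_zero μ
      (hg.differentiable one_ne_zero).differentiableOn hS))

theorem EmbedsInDim.of_finrank {X : Type*} [TopologicalSpace X] {d : ℕ} {K : Set X}
    {V : Type*} [NormedAddCommGroup V] [NormedSpace ℝ V] [FiniteDimensional ℝ V]
    (hV : Module.finrank ℝ V = d) (hK : IsCompact K) {j : X → V} (hj : ContinuousOn j K)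
    (hinj : InjOn j K) : EmbedsInDim d K := by
  let e : V ≃L[ℝ] EuclideanSpace ℝ (Fin d) := ContinuousLinearEquiv.ofFinrankEq (by simpa using hV)
  exact ⟨hK, e ∘ j, e.continuous.comp_continuousOn hj, e.injective.comp_injOn hinj⟩

theorem Topology.IsEmbedding.continuousOn_invFun {X Y : Type*} [TopologicalSpace X]
    [TopologicalSpace Y] [Nonempty X] {f : X → Y} (hf : IsEmbedding f) :
    ContinuousOn (Function.invFun f) (range f) := by
  rw [hf.isInducing.continuousOn_iff]
  refine continuousOn_id.congr ?_
  rintro _ ⟨x, rfl⟩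
  simp [Function.leftInverse_invFun hf.injective x]

theorem EmbedsInDim.image {X Y : Type*} [TopologicalSpace X] [TopologicalSpace Y] {d : ℕ}
    {K : Set X} (h : EmbedsInDim d K) {f : X → Y} (hf : IsEmbedding f) :
    EmbedsInDim d (f '' K) := by
  obtain ⟨hK, j, hj, hinj⟩ := h
  rcases isEmpty_or_nonempty X with hX | hX
  · rw [eq_empty_of_isEmpty K, image_empty]
    exact ⟨isCompact_empty, fun _ ↦ 0, continuousOn_empty _, injOn_empty _⟩
  have hl := Function.leftInverse_invFun hf.injective
  refine ⟨hK.image hf.continuous, j ∘ Function.invFun f, ?_, ?_⟩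
  · refine hj.comp (hf.continuousOn_invFun.mono (image_subset_range f K)) ?_
    rintro _ ⟨x, hx, rfl⟩
    rwa [hl x]
  · rintro _ ⟨x, hx, rfl⟩ _ ⟨y, hy, rfl⟩ hxy
    simp only [Function.comp_apply, hl x, hl y] at hxy
    rw [hinj hx hy hxy]

/-- The embedding can be placed in a proper linear subspace of `W`, which is null, and `C¹` maps
keep null sets null. -/
theorem EmbedsInDim.isThin {X : Type*} [TopologicalSpace X] {d : ℕ} {K : Set X}
    (h : EmbedsInDim d K) {W : Type*} [NormedAddCommGroup W] [NormedSpace ℝ W]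
    [FiniteDimensional ℝ W] (hd : d < Module.finrank ℝ W) : IsThin W K := by
  obtain ⟨hK, j, hj, hinj⟩ := h
  obtain ⟨L, hL⟩ : ∃ L : EuclideanSpace ℝ (Fin d) →ₗ[ℝ] W, Function.Injective L :=
    finrank_le_iff_exists_linearMap.1 (by simpa using hd.le)
  have hLc : Continuous L := L.continuous_of_finiteDimensional
  refine ⟨hK, L ∘ j, hLc.comp_continuousOn hj, hL.comp_injOn hinj, fun g hg ↦ ?_⟩
  borelize W
  refine dense_compl_image_of_null Measure.addHaar ?_ hg
  refine measure_mono_null ?_ (Measure.addHaar_submodule Measure.addHaar (LinearMap.range L) ?_)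
  · rintro _ ⟨x, -, rfl⟩
    exact ⟨j x, rfl⟩
  · intro htop
    have := LinearMap.finrank_range_of_inj hL
    rw [htop, finrank_top, finrank_euclideanSpace_fin] at this
    exact hd.ne' this

/-- Thinness here comes from measure zero, with no embedding in a smaller dimension; this is the
case used for invariance of domain. -/
theorem isThin_sphere {W : Type*} [NormedAddCommGroup W] [NormedSpace ℝ W]
    [FiniteDimensional ℝ W] (c : W) {r : ℝ} (hr : r ≠ 0) : IsThin W (sphere c r) := by
  refine ⟨isCompact_sphere c r, id, continuousOn_id, injOn_id _, fun g hg ↦ ?_⟩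
  borelize W
  rw [image_id]
  exact dense_compl_image_of_null Measure.addHaar (Measure.addHaar_sphere_of_ne_zero _ c hr) hg

/-- A continuous map to `W` can be perturbed to have no zero on a thin set. -/
theorem IsThin.exists_perturbation {X : Type*} [TopologicalSpace X] [T4Space X]
    {W : Type*} [NormedAddCommGroup W] [NormedSpace ℝ W] [FiniteDimensional ℝ W]
    {K : Set X} (hK : IsThin W K) (h : C(X, W)) {ε : ℝ} (hε : 0 < ε) :
    ∃ h' : C(X, W), (∀ x, ‖h' x - h x‖ ≤ ε) ∧ ∀ x ∈ K, h' x ≠ 0 := by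
  obtain ⟨hKc, j, hj, hinj, hthin⟩ := hK
  have : CompactSpace K := isCompact_iff_compactSpace.1 hKc
  have he : IsClosedEmbedding (K.domRestrict j) :=
    (continuousOn_iff_continuous_domRestrict.1 hj).isClosedEmbedding (injOn_iff_injective.1 hinj)
  -- Tietze factors `h` on `K` through `j`. With `P` a `C¹` approximation of `G` and `v` a small
  -- vector missed by `P` on `j '' K`, the map `P ∘ j - v` has no zero on `K`; its difference from
  -- `h` extends with the bound `ε`.
  obtain ⟨G, hG⟩ := (h.restrict K).exists_extension he
  have hGj : ∀ x ∈ K, G (j x) = h x := fun x hx ↦ congrArg (fun f : C(K, W) ↦ f ⟨x, hx⟩) hG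
  obtain ⟨P, hP, hPG, -⟩ := G.continuous.exists_contDiff_approx 1 (ε := fun _ ↦ ε / 2)
    continuous_const fun _ ↦ half_pos hε
  obtain ⟨v, hvP, hv⟩ := (hthin P hP).exists_dist_lt 0 (half_pos hε)
  rw [dist_zero_left] at hv
  have hPj : ContinuousOn (fun x ↦ P (j x)) K := hP.continuous.comp_continuousOn hj
  let u : C(K, W) := ⟨K.domRestrict fun x ↦ P (j x) - v - h x,
    continuousOn_iff_continuous_domRestrict.1
      ((hPj.sub continuousOn_const).sub h.continuous.continuousOn)⟩
  have hu : ∀ x, u x ∈ closedBall (0 : W) ε := fun x ↦ by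
    have h1 := hPG (j x)
    rw [dist_eq_norm, hGj x x.2] at h1
    have h2 : u x = P (j x) - h x - v := by
      change P (j x) - v - h x = _
      abel
    rw [mem_closedBall_zero_iff, h2]
    linarith [norm_sub_le (P (j x) - h x) v]
  have := Metric.instTietzeExtensionClosedBall ℝ (0 : W) hε
  obtain ⟨U, hU, hUu⟩ := u.exists_forall_mem_restrict_eq hKc.isClosed hu
  refine ⟨h + U, fun x ↦ by simpa using hU x, fun x hx h0 ↦ hvP ⟨j x, ⟨x, hx, rfl⟩, ?_⟩⟩
  have h1 : U x = P (j x) - v - h x := congrArg (fun f : C(K, W) ↦ f ⟨x, hx⟩) hUu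
  rw [ContinuousMap.add_apply, h1, add_sub_cancel] at h0
  exact sub_eq_zero.1 h0

/-- A continuous map to `W` can be perturbed to have no zero on a finite union of thin sets. -/
theorem exists_perturbation_of_finset {X : Type*} [TopologicalSpace X] [T4Space X]
    {W : Type*} [NormedAddCommGroup W] [NormedSpace ℝ W] [FiniteDimensional ℝ W]
    {ι : Type*} (s : Finset ι) {K : ι → Set X} (hK : ∀ i ∈ s, IsThin W (K i)) (h : C(X, W))
    {ε : ℝ} (hε : 0 < ε) :
    ∃ h' : C(X, W), (∀ x, ‖h' x - h x‖ ≤ ε) ∧ ∀ i ∈ s, ∀ x ∈ K i, h' x ≠ 0 := by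
  classical
  induction s using Finset.induction_on generalizing ε with
  | empty => exact ⟨h, by simp [hε.le], by simp⟩
  | insert i s _ ih =>
    obtain ⟨h₁, hh₁, hne₁⟩ := ih (fun k hk ↦ hK k (Finset.mem_insert_of_mem hk)) (half_pos hε)
    have hc : IsCompact (⋃ k ∈ s, K k) :=
      s.isCompact_biUnion fun k hk ↦ (hK k (Finset.mem_insert_of_mem hk)).1
    -- The next perturbation stays below half of this lower bound, so it creates no zero on the sets
    -- already treated.
    obtain ⟨δ, hδ, hδle⟩ := hc.exists_forall_le' (f := fun x ↦ ‖h₁ x‖) (by fun_prop) (a := 0)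
      fun x hx ↦ by
        obtain ⟨k, hk, hxk⟩ := mem_iUnion₂.1 hx
        exact norm_pos_iff.2 (hne₁ k hk x hxk)
    obtain ⟨h₂, hh₂, hne₂⟩ := (hK i (Finset.mem_insert_self i s)).exists_perturbation h₁
      (lt_min (half_pos hε) (half_pos hδ))
    refine ⟨h₂, fun x ↦ ?_, fun k hk x hx ↦ ?_⟩
    · have h3 := norm_add_le (h₂ x - h₁ x) (h₁ x - h x)
      rw [sub_add_sub_cancel] at h3
      linarith [hh₁ x, (hh₂ x).trans (min_le_left _ _)]
    · rcases Finset.mem_insert.1 hk with rfl | hk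
      · exact hne₂ x hx
      · intro h0
        have h3 := (hh₂ x).trans (min_le_right _ _)
        rw [h0, zero_sub, norm_neg] at h3
        linarith [hδle x (mem_iUnion₂.2 ⟨k, hk, hx⟩)]

variable {E : Type*} [NormedAddCommGroup E] [InnerProductSpace ℝ E] [FiniteDimensional ℝ E]

/-- Testing the variational inequality at `x - D x` gives `-‖D x‖ ^ 2 ≥ 0`. -/
theorem exists_eq_zero_of_sub_mem {C : Set E} (hne : C.Nonempty) (hC : IsCompact C)
    (hconv : Convex ℝ C) {D : E → E} (hD : ContinuousOn D C) (hmem : ∀ x ∈ C, x - D x ∈ C) :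
    ∃ x ∈ C, D x = 0 := by
  obtain ⟨x, hx, h⟩ := exists_forall_inner_nonneg hne hC hconv hD
  refine ⟨x, hx, ?_⟩
  have := h _ (hmem x hx)
  rw [sub_sub_cancel_left, inner_neg_right, real_inner_self_eq_norm_sq] at this
  exact norm_eq_zero.1 (by nlinarith [norm_nonneg (D x)])

/-- A small perturbation of `x ↦ x - a` still has a zero near `a`, yet it can be chosen without
zeros on the thin sets. -/
theorem not_subset_iUnion_isThin {U : Set E} (hU : IsOpen U) (hne : U.Nonempty) {ι : Type*}
    (s : Finset ι) {K : ι → Set E} (hK : ∀ i ∈ s, IsThin E (K i)) : ¬ U ⊆ ⋃ i ∈ s, K i := by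
  intro hsub
  obtain ⟨a, ha⟩ := hne
  obtain ⟨r, hr, hball⟩ := Metric.nhds_basis_closedBall.mem_iff.1 (hU.mem_nhds ha)
  obtain ⟨h, hh, hne⟩ := exists_perturbation_of_finset s hK
    ⟨fun x ↦ x - a, continuous_id.sub continuous_const⟩ hr
  obtain ⟨x, hx, h0⟩ := exists_eq_zero_of_sub_mem ⟨a, mem_closedBall_self hr.le⟩
    (isCompact_closedBall a r) (convex_closedBall a r) h.continuous.continuousOn fun x _ ↦ by
      rw [mem_closedBall, dist_eq_norm, ← norm_neg]
      have h1 : -(x - h x - a) = h x - (x - a) := by abel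
      rw [h1]
      exact hh x
  obtain ⟨i, hi, hxi⟩ := mem_iUnion₂.1 (hsub (hball hx))
  exact hne i hi x hxi h0

/-- Finitely many compact sets of codimension at least two do not separate a convex set. -/
theorem not_separated_by_codim_two {B G H : Set E} (hB : Convex ℝ B) (hG : IsOpen G)
    (hH : IsOpen H) (hGB : G ⊆ B) (hHB : H ⊆ B) (hGH : Disjoint G H) (hGne : G.Nonempty)
    (hHne : H.Nonempty) {ι : Type*} (s : Finset ι) {K : ι → Set E} {d : ι → ℕ}
    (hK : ∀ i ∈ s, EmbedsInDim (d i) (K i) ∧ d i + 1 < Module.finrank ℝ E) :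
    ¬ B ⊆ G ∪ H ∪ ⋃ i ∈ s, K i := by
  intro hcov
  obtain ⟨a, ha⟩ := hHne
  obtain ⟨b, hb⟩ := hGne
  set e := b - a
  have he : e ≠ 0 := sub_ne_zero.2 fun h ↦ hGH.ne_of_mem hb ha h
  -- `W` has dimension one less than `E`, so sets of codimension at least two in `E` are still thin
  -- for `W`, and the projection to `W` can be perturbed to `h` without zeros on them.
  set W : Submodule ℝ E := (ℝ ∙ e)ᗮ
  have hW : Module.finrank ℝ W + 1 = Module.finrank ℝ E := by
    rw [← (ℝ ∙ e).finrank_add_finrank_orthogonal, finrank_span_singleton he, add_comm]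
  obtain ⟨ρ₁, hρ₁, hball₁⟩ := Metric.nhds_basis_closedBall.mem_iff.1 (hH.mem_nhds ha)
  obtain ⟨ρ₂, hρ₂, hball₂⟩ := Metric.nhds_basis_closedBall.mem_iff.1 (hG.mem_nhds hb)
  set ρ := min ρ₁ ρ₂
  have hρ : 0 < ρ := lt_min hρ₁ hρ₂
  have hwH : ∀ w : W, ‖w‖ ≤ ρ → a + w ∈ H := fun w hw ↦
    hball₁ (by simpa using hw.trans (min_le_left _ _))
  have hwG : ∀ w : W, ‖w‖ ≤ ρ → b + w ∈ G := fun w hw ↦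
    hball₂ (by simpa using hw.trans (min_le_right _ _))
  obtain ⟨h, hh, hne⟩ := exists_perturbation_of_finset s
    (fun i hi ↦ (hK i hi).1.isThin (W := W) (by have := (hK i hi).2; omega))
    (⟨fun x ↦ W.orthogonalProjectionOnto (x - a), by fun_prop⟩ : C(E, W)) hρ
  let L : ℝ × W →ₗ[ℝ] E := (LinearMap.toSpanSingleton ℝ E e).coprod W.subtype
  have hL : ∀ t w, L (t, w) = t • e + w := fun t w ↦ by simp [L]
  set C : Set E := (fun z ↦ a + z) '' (L '' (Icc (0 : ℝ) 1 ×ˢ closedBall (0 : W) ρ))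
  have hmem : ∀ (t : ℝ) (w : W), t ∈ Icc (0 : ℝ) 1 → ‖w‖ ≤ ρ → a + (t • e + w) ∈ C :=
    fun t w ht hw ↦ ⟨_, ⟨(t, w), ⟨ht, by simpa using hw⟩, rfl⟩, by rw [hL]⟩
  have hCc : IsCompact C := ((isCompact_Icc.prod (isCompact_closedBall _ _)).image
    L.continuous_of_finiteDimensional).image (by fun_prop)
  have hCconv : Convex ℝ C :=
    (((convex_Icc 0 1).prod (convex_closedBall _ _)).linear_image L).translate a
  -- Positive on `G` and negative on `H`; a common zero of `g` and `h` in `B` therefore escapes the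
  -- cover.
  set g : E → ℝ := fun x ↦ infDist x Gᶜ - infDist x Hᶜ
  have hgc : Continuous g := (continuous_infDist_pt _).sub (continuous_infDist_pt _)
  have hGc : (Gᶜ).Nonempty := ⟨a, fun h ↦ hGH.ne_of_mem h ha rfl⟩
  have hHc : (Hᶜ).Nonempty := ⟨b, fun h ↦ hGH.ne_of_mem hb h rfl⟩
  have hgG : ∀ x ∈ G, 0 < g x := fun x hx ↦ by
    have h1 := (hG.isClosed_compl.notMem_iff_infDist_pos hGc (x := x)).1 (by simpa using hx)
    have h2 : infDist x Hᶜ = 0 := infDist_zero_of_mem fun h ↦ hGH.ne_of_mem hx h rfl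
    simp only [g, h2]
    linarith
  have hgH : ∀ x ∈ H, g x < 0 := fun x hx ↦ by
    have h1 := (hH.isClosed_compl.notMem_iff_infDist_pos hHc (x := x)).1 (by simpa using hx)
    have h2 : infDist x Gᶜ = 0 := infDist_zero_of_mem fun h ↦ hGH.ne_of_mem h hx rfl
    simp only [g, h2]
    linarith
  obtain ⟨_, ⟨_, ⟨⟨t, w⟩, ⟨ht, hw⟩, rfl⟩, rfl⟩, hvi⟩ := exists_forall_inner_nonneg
    (D := fun x ↦ g x • e + (h x : E)) ⟨_, hmem 0 0 (by simp) (by simpa using hρ.le)⟩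
    hCc hCconv (by
      have := h.continuous
      exact Continuous.continuousOn (by fun_prop))
  simp only [hL] at hvi
  have hw' : ‖w‖ ≤ ρ := by simpa using hw
  set x := a + (t • e + (w : E))
  have heW : ∀ u : W, ⟪e, (u : E)⟫ = 0 := fun u ↦
    Submodule.mem_orthogonal_singleton_iff_inner_right.1 u.2
  have hproj : W.orthogonalProjectionOnto (x - a) = w := by
    have h1 : W.orthogonalProjectionOnto e = 0 :=
      Submodule.orthogonalProjectionOnto_orthogonal_apply_eq_zero (Submodule.mem_span_singleton_self e)
    simp only [x, add_sub_cancel_left, map_add, map_smul, h1, smul_zero, zero_add,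
      Submodule.orthogonalProjectionOnto_mem_subspace_eq_self]
  have key : ∀ (t' : ℝ) (w' : W), t' ∈ Icc (0 : ℝ) 1 → ‖w'‖ ≤ ρ →
      0 ≤ g x * ((t' - t) * ‖e‖ ^ 2) + ⟪h x, w' - w⟫ := fun t' w' ht' hw'' ↦ by
    have h1 := hvi _ (hmem t' w' ht' hw'')
    have h2 : a + (t' • e + (w' : E)) - x = (t' - t) • e + ((w' - w : W) : E) := by
      simp only [x, Submodule.coe_sub]; module
    rw [h2, inner_add_left, inner_add_right, inner_add_right, real_inner_smul_left,
      real_inner_smul_left, real_inner_smul_right, real_inner_smul_right, heW,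
      real_inner_comm e (h x : E), heW, real_inner_self_eq_norm_sq] at h1
    simpa using h1
  -- `h x` is within `ρ` of `w`, so `w - h x` is an admissible test point.
  have hx0 : h x = 0 := by
    have h1 := key t (w - h x) ht (by
      have := hh x
      simp only [ContinuousMap.coe_mk, hproj] at this
      rwa [norm_sub_rev])
    rw [sub_self, zero_mul, mul_zero, zero_add, sub_sub_cancel_left, inner_neg_right,
      real_inner_self_eq_norm_sq] at h1
    exact norm_eq_zero.1 (by nlinarith [norm_nonneg (h x)])
  have he2 : 0 < ‖e‖ ^ 2 := by positivity
  -- A nonzero `g x` pushes the solution to an end of the box. The end `t = 1` lies in `G` and `t =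
  -- 0` in `H`, where `g` has the opposite sign.
  have hg0 : g x = 0 := by
    rcases lt_trichotomy (g x) 0 with hlt | h0 | hgt
    · have h1 := key 1 w (by simp) hw'
      rw [sub_self, inner_zero_right, add_zero] at h1
      have h2 : t = 1 := by
        refine ht.2.antisymm (not_lt.1 fun h ↦ ?_)
        have : 0 < (1 - t) * ‖e‖ ^ 2 := mul_pos (by linarith) he2
        nlinarith
      have h3 : x = b + w := by simp only [x, h2, e]; module
      exact absurd (hgG x (h3 ▸ hwG w hw')) (not_lt.2 hlt.le)
    · exact h0
    · have h1 := key 0 w (by simp) hw'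
      rw [sub_self, inner_zero_right, add_zero] at h1
      have h2 : t = 0 := by
        refine (not_lt.1 fun h ↦ ?_ : t ≤ 0).antisymm ht.1
        have : 0 < t * ‖e‖ ^ 2 := mul_pos h he2
        nlinarith
      have h3 : x = a + w := by simp only [x, h2]; module
      exact absurd (hgH x (h3 ▸ hwH w hw')) (not_lt.2 hgt.le)
  have hxB : x ∈ B := by
    have := hB (hHB (hwH w hw')) (hGB (hwG w hw')) (sub_nonneg.2 ht.2) ht.1 (by ring)
    convert this using 1
    simp only [x, e]
    module
  rcases hcov hxB with (hx | hx) | hx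
  · exact (hgG x hx).ne' hg0
  · exact (hgH x hx).ne hg0
  · obtain ⟨i, hi, hxi⟩ := mem_iUnion₂.1 hx
    exact hne i hi x hxi hx0

/-- Invariance of domain at the centre of a ball. -/
theorem mem_interior_image_closedBall {f : E → E} (hf : ContinuousOn f (closedBall 0 1))
    (hinj : InjOn f (closedBall 0 1)) : f 0 ∈ interior (f '' closedBall 0 1) := by
  by_contra hnot
  set B : Set E := closedBall 0 1
  have hBc : IsCompact B := isCompact_closedBall 0 1
  set K := f '' B
  have hKc : IsCompact K := hBc.image_of_continuousOn hf
  have h0B : (0 : E) ∈ B := by simp [B]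
  have : CompactSpace B := isCompact_iff_compactSpace.1 hBc
  have he : IsClosedEmbedding (B.domRestrict f) :=
    (continuousOn_iff_continuous_domRestrict.1 hf).isClosedEmbedding (injOn_iff_injective.1 hinj)
  -- `G` is a continuous extension of the inverse of `f`; on `K` it vanishes only at `f 0`.
  obtain ⟨G, hG⟩ := (⟨Subtype.val, continuous_subtype_val⟩ : C(B, E)).exists_extension he
  have hGf : ∀ x ∈ B, G (f x) = x := fun x hx ↦ congrArg (fun f : C(B, E) ↦ f ⟨x, hx⟩) hG
  obtain ⟨ε, hε, hGε⟩ : ∃ ε > 0, ∀ y, dist y (f 0) < 3 * ε → ‖G y‖ < 1 / 10 := by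
    obtain ⟨η, hη, h⟩ := Metric.continuousAt_iff.1 (G.continuous.continuousAt (x := f 0)) (1 / 10)
      (by norm_num)
    refine ⟨η / 3, by positivity, fun y hy ↦ ?_⟩
    have := h (x := y) (by linarith)
    rwa [hGf 0 h0B, dist_zero_right] at this
  obtain ⟨c, hcK, hcd⟩ : ∃ c ∉ K, dist c (f 0) < ε := by
    by_contra! h
    refine hnot (mem_interior_iff_mem_nhds.2 (Filter.mem_of_superset (ball_mem_nhds _ hε) ?_))
    intro c hc
    by_contra hcK
    exact absurd (h c hcK) (not_le.2 hc)
  have hfarc : IsCompact (K ∩ {y | ε ≤ dist y c}) :=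
    hKc.inter_right (isClosed_le continuous_const (continuous_id.dist continuous_const))
  obtain ⟨δ, hδ, hδle⟩ := hfarc.exists_forall_le' (f := fun y ↦ ‖G y‖) (by fun_prop) (a := 0) <| by
    rintro _ ⟨⟨x, hx, rfl⟩, hxc⟩
    rw [hGf x hx]
    refine norm_pos_iff.2 fun h ↦ ?_
    rw [h, mem_ofPred_eq, dist_comm] at hxc
    exact absurd hcd (not_lt.2 hxc)
  -- The bound `δ / 2` keeps `G'` nonzero on the part of `K` outside the ball about `c`; the bound
  -- `1 / 10` keeps `x - G' (Φ (f x))` in the unit ball.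
  obtain ⟨G', hG', hne'⟩ := (isThin_sphere c hε.ne').exists_perturbation G
    (lt_min (half_pos hδ) (by norm_num : (0 : ℝ) < 1 / 10))
  -- Since `c ∉ K`, the part of `K` within `ε` of `c` can be pushed radially to the sphere, while
  -- the rest stays fixed. Then `G'` has no zero on `Φ '' K`, though Brouwer provides one.
  set Φ : E → E := fun y ↦ c + max (ε / dist y c) 1 • (y - c)
  have hdist : ∀ y ∈ K, 0 < dist y c := fun y hy ↦ dist_pos.2 fun h ↦ hcK (h ▸ hy)
  have hΦ : ContinuousOn Φ K := by
    refine continuousOn_const.add (ContinuousOn.smul ?_ (by fun_prop))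
    exact ContinuousOn.sup (continuousOn_const.div (by fun_prop) fun y hy ↦ (hdist y hy).ne')
      continuousOn_const
  have hΦfar : ∀ y ∈ K, ε ≤ dist y c → Φ y = y := fun y hy h ↦ by
    simp only [Φ]
    rw [max_eq_right (div_le_one_of_le₀ h dist_nonneg), one_smul, add_sub_cancel]
  have hΦnear : ∀ y ∈ K, dist y c ≤ ε → dist (Φ y) c = ε := fun y hy h ↦ by
    simp only [Φ]
    rw [max_eq_left ((one_le_div₀ (hdist y hy)).2 h), dist_self_add_left, norm_smul,
      Real.norm_of_nonneg (by positivity), ← dist_eq_norm, div_mul_cancel₀ _ (hdist y hy).ne']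
  obtain ⟨x, hx, h0⟩ := exists_eq_zero_of_sub_mem ⟨0, h0B⟩ hBc (convex_closedBall 0 1)
    (D := fun x ↦ G' (Φ (f x))) (G'.continuous.comp_continuousOn (hΦ.comp hf (mapsTo_image f B)))
    fun x hx ↦ by
      rw [mem_closedBall_zero_iff]
      have hxK : f x ∈ K := mem_image_of_mem f hx
      have h1 := (hG' (Φ (f x))).trans (min_le_right _ _)
      rcases le_total ε (dist (f x) c) with h | h
      · rw [hΦfar _ hxK h, hGf x hx] at h1
        rw [hΦfar _ hxK h, norm_sub_rev]
        linarith
      · have h2 := hGε (f x) (by linarith [dist_triangle (f x) c (f 0)])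
        have h3 := hGε (Φ (f x)) (by
          linarith [dist_triangle (Φ (f x)) c (f 0), hΦnear _ hxK h])
        rw [hGf x hx] at h2
        have h4 := norm_add_le (G' (Φ (f x)) - G (Φ (f x))) (G (Φ (f x)))
        rw [sub_add_cancel] at h4
        linarith [norm_sub_le x (G' (Φ (f x)))]
  have hxK : f x ∈ K := mem_image_of_mem f hx
  rcases le_total ε (dist (f x) c) with h | h
  · have h1 := (hG' (Φ (f x))).trans (min_le_left _ _)
    rw [h0, hΦfar _ hxK h, zero_sub, norm_neg] at h1
    linarith [hδle _ ⟨hxK, h⟩]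
  · exact hne' _ (hΦnear _ hxK h) h0

/-- **Invariance of domain**. -/
theorem isOpen_image_of_injOn {V W : Type*} [NormedAddCommGroup V] [NormedSpace ℝ V]
    [FiniteDimensional ℝ V] [NormedAddCommGroup W] [NormedSpace ℝ W] [FiniteDimensional ℝ W]
    (hVW : Module.finrank ℝ V = Module.finrank ℝ W) {U : Set V} (hU : IsOpen U) {f : V → W}
    (hf : ContinuousOn f U) (hinj : InjOn f U) : IsOpen (f '' U) := by
  let n := Module.finrank ℝ V
  let α : EuclideanSpace ℝ (Fin n) ≃L[ℝ] V := ContinuousLinearEquiv.ofFinrankEq (by simp [n])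
  let β : EuclideanSpace ℝ (Fin n) ≃L[ℝ] W := ContinuousLinearEquiv.ofFinrankEq (by simp [n, hVW])
  rw [isOpen_iff_mem_nhds]
  rintro _ ⟨x, hx, rfl⟩
  let τ : EuclideanSpace ℝ (Fin n) → V := fun z ↦ x + α z
  have hτ : Continuous τ := by fun_prop
  have hτU : τ ⁻¹' U ∈ 𝓝 0 := hτ.continuousAt.preimage_mem_nhds (hU.mem_nhds (by simpa [τ] using hx))
  obtain ⟨r, hr, hball⟩ := Metric.nhds_basis_closedBall.mem_iff.1 hτU
  have hmaps : ∀ z ∈ closedBall (0 : EuclideanSpace ℝ (Fin n)) 1, τ (r • z) ∈ U := fun z hz ↦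
    hball (by
      rw [mem_closedBall_zero_iff] at hz ⊢
      rw [norm_smul, Real.norm_of_nonneg hr.le]
      exact mul_le_of_le_one_right hr.le hz)
  have key := mem_interior_image_closedBall (f := fun z ↦ β.symm (f (τ (r • z))))
    (β.symm.continuous.comp_continuousOn
      (hf.comp (hτ.comp (continuous_const_smul r)).continuousOn hmaps))
    (fun z hz w hw h ↦ by
      have h1 := hinj (hmaps z hz) (hmaps w hw) (β.symm.injective h)
      exact smul_right_injective _ hr.ne' (α.injective (add_left_cancel h1)))
  have h2 : β '' ((fun z ↦ β.symm (f (τ (r • z)))) '' closedBall 0 1) ∈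
      𝓝 (β (β.symm (f (τ (r • (0 : EuclideanSpace ℝ (Fin n))))))) :=
    β.toHomeomorph.isOpenMap.image_mem_nhds (mem_interior_iff_mem_nhds.1 key)
  simp only [smul_zero, τ, map_zero, add_zero, ContinuousLinearEquiv.apply_symm_apply] at h2
  refine Filter.mem_of_superset h2 ?_
  rintro _ ⟨_, ⟨z, hz, rfl⟩, rfl⟩
  rw [ContinuousLinearEquiv.apply_symm_apply]
  exact mem_image_of_mem f (hmaps z hz)

end InvarianceOfDomain

/-! ### Polar coordinates: transfer of these results to arbitrary norms and unit spheres. -/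

section Polar

variable {V : Type*} [NormedAddCommGroup V] [NormedSpace ℝ V]

/-- The radial projection onto the unit sphere. -/
noncomputable def radial (x : V) : V := ‖x‖⁻¹ • x

theorem norm_radial {x : V} (hx : x ≠ 0) : ‖radial x‖ = 1 := by
  rw [radial, norm_smul, norm_inv, norm_norm, inv_mul_cancel₀ (norm_ne_zero_iff.2 hx)]

theorem norm_smul_radial (x : V) : ‖x‖ • radial x = x := by
  rcases eq_or_ne x 0 with rfl | hx
  · simp
  · rw [radial, smul_inv_smul₀ (norm_ne_zero_iff.2 hx)]

theorem radial_of_norm_eq_one {x : V} (hx : ‖x‖ = 1) : radial x = x := by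
  simp [radial, hx]

theorem continuousOn_radial : ContinuousOn (radial : V → V) {0}ᶜ :=
  (continuousOn_id.norm.inv₀ fun _ hx ↦ norm_ne_zero_iff.2 hx).smul continuousOn_id

/-- The open cone over an open set of directions. -/
def openCone (N : Set V) : Set V := {x | x ≠ 0 ∧ radial x ∈ N}

theorem isOpen_openCone {N : Set V} (hN : IsOpen N) : IsOpen (openCone N) :=
  continuousOn_radial.isOpen_inter_preimage isOpen_compl_singleton hN

theorem radial_mem_of_mem_openCone {N : Set V} {x : V} (hx : x ∈ openCone N) :
    radial x ∈ sphere (0 : V) 1 ∩ N :=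
  ⟨by simpa using norm_radial hx.1, hx.2⟩

theorem mem_openCone_of_mem_sphere {N : Set V} {x : V} (hx : x ∈ sphere (0 : V) 1 ∩ N) :
    x ∈ openCone N :=
  ⟨ne_zero_of_mem_sphere one_ne_zero ⟨_, hx.1⟩, by
    rw [radial_of_norm_eq_one (by simpa using hx.1)]; exact hx.2⟩

/-- Invariance of domain for open subsets of the unit sphere. -/
theorem isOpen_image_sphere_inter [FiniteDimensional ℝ V] {W : Type*} [NormedAddCommGroup W]
    [NormedSpace ℝ W] [FiniteDimensional ℝ W]
    (hVW : Module.finrank ℝ V = Module.finrank ℝ W + 1) {N : Set V} (hN : IsOpen N) {h : V → W}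
    (hh : ContinuousOn h (sphere 0 1 ∩ N)) (hinj : InjOn h (sphere 0 1 ∩ N)) :
    IsOpen (h '' (sphere 0 1 ∩ N)) := by
  have hmaps : MapsTo radial (openCone N) (sphere 0 1 ∩ N) := fun _ ↦ radial_mem_of_mem_openCone
  have hrad : ContinuousOn (radial : V → V) (openCone N) := continuousOn_radial.mono fun x hx ↦ hx.1
  -- Adding the radius as a coordinate equalizes dimensions; the slice at radius `1` is the image
  -- sought.
  have hopen : IsOpen ((fun x ↦ (h (radial x), ‖x‖)) '' openCone N) := by
    refine isOpen_image_of_injOn (by simpa using hVW) (isOpen_openCone hN)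
      ((hh.comp hrad hmaps).prodMk continuousOn_id.norm) fun x hx y hy hxy ↦ ?_
    rw [Prod.mk.injEq] at hxy
    rw [← norm_smul_radial x, ← norm_smul_radial y, hinj (hmaps hx) (hmaps hy) hxy.1, hxy.2]
  convert hopen.preimage (Continuous.prodMk_left (1 : ℝ)) using 1
  ext w
  constructor
  · rintro ⟨x, hx, rfl⟩
    have h1 : ‖x‖ = 1 := by simpa using hx.1
    exact ⟨x, mem_openCone_of_mem_sphere hx, by simp [radial_of_norm_eq_one h1, h1]⟩
  · rintro ⟨x, hx, hxw⟩
    exact ⟨radial x, hmaps hx, congrArg Prod.fst hxw⟩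

theorem not_subset_iUnion_embedsInDim [FiniteDimensional ℝ V] {U : Set V} (hU : IsOpen U)
    (hne : U.Nonempty) {ι : Type*} (s : Finset ι) {K : ι → Set V} {d : ι → ℕ}
    (hK : ∀ i ∈ s, EmbedsInDim (d i) (K i) ∧ d i < Module.finrank ℝ V) : ¬ U ⊆ ⋃ i ∈ s, K i := by
  intro hsub
  let α : V ≃L[ℝ] EuclideanSpace ℝ (Fin (Module.finrank ℝ V)) :=
    ContinuousLinearEquiv.ofFinrankEq (by simp)
  refine not_subset_iUnion_isThin (α.toHomeomorph.isOpenMap _ hU) (hne.image _) s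
    (K := fun i ↦ α '' K i) (fun i hi ↦ ?_) ?_
  · exact ((hK i hi).1.image α.toHomeomorph.isEmbedding).isThin (by simpa using (hK i hi).2)
  · rintro _ ⟨x, hx, rfl⟩
    obtain ⟨i, hi, hxi⟩ := mem_iUnion₂.1 (hsub hx)
    exact mem_iUnion₂.2 ⟨i, hi, mem_image_of_mem _ hxi⟩

/-- Thickening the sphere to the shell of radii between `1 / 2` and `2` raises each dimension by one
and reduces to open sets of `V`. -/
theorem not_sphere_inter_subset_iUnion_embedsInDim [FiniteDimensional ℝ V] {N : Set V}
    (hN : IsOpen N) (hne : (sphere (0 : V) 1 ∩ N).Nonempty) {ι : Type*} (s : Finset ι)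
    {K : ι → Set V} {d : ι → ℕ}
    (hK : ∀ i ∈ s, EmbedsInDim (d i) (K i) ∧ d i + 1 < Module.finrank ℝ V) :
    ¬ sphere 0 1 ∩ N ⊆ ⋃ i ∈ s, K i := by
  intro hsub
  have hU : IsOpen (openCone N ∩ {x | ‖x‖ ∈ Ioo (1 / 2 : ℝ) 2}) :=
    (isOpen_openCone hN).inter (isOpen_Ioo.preimage continuous_norm)
  refine not_subset_iUnion_embedsInDim hU ?_ s (d := fun i ↦ d i + 1)
    (K := fun i ↦ (fun p : ℝ × V ↦ p.1 • p.2) '' (Icc (1 / 2 : ℝ) 2 ×ˢ (sphere 0 1 ∩ K i)))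
    (fun i hi ↦ ⟨?_, (hK i hi).2⟩) ?_
  · obtain ⟨x, hx⟩ := hne
    refine ⟨x, mem_openCone_of_mem_sphere hx, ?_⟩
    have h1 : ‖x‖ = 1 := by simpa using hx.1
    rw [mem_ofPred_eq, h1]
    norm_num
  · obtain ⟨⟨hKc, j, hj, hinj⟩, -⟩ := hK i hi
    have hprop : ∀ x ∈ (fun p : ℝ × V ↦ p.1 • p.2) '' (Icc (1 / 2 : ℝ) 2 ×ˢ (sphere 0 1 ∩ K i)),
        x ≠ 0 ∧ radial x ∈ K i := by
      rintro _ ⟨⟨t, x⟩, ⟨ht, hx⟩, rfl⟩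
      have ht0 : (0 : ℝ) < t := lt_of_lt_of_le (by norm_num) ht.1
      have h1 : ‖x‖ = 1 := by simpa using hx.1
      refine ⟨smul_ne_zero ht0.ne' (ne_zero_of_mem_sphere one_ne_zero ⟨_, hx.1⟩), ?_⟩
      simp only [radial, norm_smul, Real.norm_of_nonneg ht0.le, h1, mul_one]
      rw [inv_smul_smul₀ ht0.ne']
      exact hx.2
    refine EmbedsInDim.of_finrank (V := EuclideanSpace ℝ (Fin (d i)) × ℝ) (by simp)
      ((isCompact_Icc.prod ((isCompact_sphere 0 1).inter_right hKc.isClosed)).image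
        (by fun_prop)) (j := fun x ↦ (j (radial x), ‖x‖)) ?_ ?_
    · exact (hj.comp (continuousOn_radial.mono fun x hx ↦ (hprop x hx).1)
        fun x hx ↦ (hprop x hx).2).prodMk continuousOn_id.norm
    · intro x hx y hy hxy
      rw [Prod.mk.injEq] at hxy
      rw [← norm_smul_radial x, ← norm_smul_radial y,
        hinj (hprop x hx).2 (hprop y hy).2 hxy.1, hxy.2]
  · rintro x ⟨hx, hx2⟩
    obtain ⟨i, hi, hxi⟩ := mem_iUnion₂.1 (hsub (radial_mem_of_mem_openCone hx))
    exact mem_iUnion₂.2 ⟨i, hi, (‖x‖, radial x),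
      ⟨Ioo_subset_Icc_self hx2, (radial_mem_of_mem_openCone hx).1, hxi⟩, norm_smul_radial x⟩

end Polar

/-! ### Face structure of finite regular CW complexes. -/

namespace RegularCW

variable {X : Type*} [TopologicalSpace X] [CWComplex (univ : Set X)]

/-- The open cell of a cell. -/
def Cell.inner (c : Cell X) : Set X := RelCWComplex.openCell c.1 c.2

/-- The boundary of a cell. -/
def Cell.boundary (c : Cell X) : Set X := RelCWComplex.cellFrontier c.1 c.2

theorem Cell.inner_subset_carrier (c : Cell X) : c.inner ⊆ c.carrier :=
  RelCWComplex.openCell_subset_closedCell _ _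

theorem Cell.boundary_subset_carrier (c : Cell X) : c.boundary ⊆ c.carrier :=
  RelCWComplex.cellFrontier_subset_closedCell _ _

theorem Cell.mem_boundary_or_mem_inner {c : Cell X} {x : X} (hx : x ∈ c.carrier) :
    x ∈ c.boundary ∨ x ∈ c.inner := by
  rwa [Cell.carrier, ← RelCWComplex.cellFrontier_union_openCell_eq_closedCell] at hx

theorem Cell.isCompact_carrier (c : Cell X) : IsCompact c.carrier :=
  RelCWComplex.isCompact_closedCell

theorem Cell.eq_of_mem_inner {c d : Cell X} {x : X} (hc : x ∈ c.inner) (hd : x ∈ d.inner) :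
    c = d :=
  RelCWComplex.eq_of_not_disjoint_openCell (Set.not_disjoint_iff.2 ⟨x, hc, hd⟩)

theorem exists_mem_inner (x : X) : ∃ c : Cell X, x ∈ c.inner := by
  have hx : x ∈ (univ : Set X) := mem_univ x
  rw [← CWComplex.iUnion_openCell_eq_complex (C := (univ : Set X))] at hx
  simp only [mem_iUnion] at hx
  obtain ⟨n, j, h⟩ := hx
  exact ⟨⟨n, j⟩, h⟩

theorem Cell.exists_mem_inner_of_mem_boundary {c : Cell X} {x : X} (hx : x ∈ c.boundary) :
    ∃ d : Cell X, d.1 < c.1 ∧ x ∈ d.inner := by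
  obtain ⟨I, hI⟩ := CWComplex.cellFrontier_subset_finite_openCell c.1 c.2
  have := hI hx
  simp only [mem_iUnion] at this
  obtain ⟨m, hm, j, -, h⟩ := this
  exact ⟨⟨m, j⟩, hm, h⟩

theorem Cell.dim_lt_of_mem_boundary {c d : Cell X} {x : X} (hx : x ∈ c.boundary)
    (hd : x ∈ d.inner) : d.1 < c.1 := by
  obtain ⟨d', hlt, hd'⟩ := exists_mem_inner_of_mem_boundary hx
  rwa [eq_of_mem_inner hd hd']

theorem Cell.dim_lt_or_eq {c d : Cell X} {x : X} (hx : x ∈ c.carrier) (hd : x ∈ d.inner) :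
    d.1 < c.1 ∨ d = c :=
  (mem_boundary_or_mem_inner hx).imp (dim_lt_of_mem_boundary · hd) (eq_of_mem_inner hd)

theorem Cell.continuousOn_map (c : Cell X) :
    ContinuousOn (RelCWComplex.map c.1 c.2) (closedBall 0 1) :=
  RelCWComplex.continuousOn _ _

theorem Cell.map_mem_carrier (c : Cell X) {v : Fin c.1 → ℝ} (hv : v ∈ closedBall 0 1) :
    RelCWComplex.map c.1 c.2 v ∈ c.carrier := mem_image_of_mem _ hv

theorem Cell.map_mem_inner (c : Cell X) {v : Fin c.1 → ℝ} (hv : v ∈ ball 0 1) :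
    RelCWComplex.map c.1 c.2 v ∈ c.inner := mem_image_of_mem _ hv

theorem Cell.map_mem_boundary (c : Cell X) {v : Fin c.1 → ℝ} (hv : v ∈ sphere 0 1) :
    RelCWComplex.map c.1 c.2 v ∈ c.boundary := mem_image_of_mem _ hv

theorem IsRegular.injOn_map (hreg : IsRegular X) (c : Cell X) :
    InjOn (RelCWComplex.map c.1 c.2) (closedBall 0 1) :=
  injOn_iff_injective.2 (hreg c.1 c.2).injective

/-- A characteristic map of a regular complex has a continuous inverse on the closed cell. -/
theorem IsRegular.exists_inverse (hreg : IsRegular X) (c : Cell X) :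
    ∃ ψ : X → Fin c.1 → ℝ, ContinuousOn ψ c.carrier ∧
      (∀ v ∈ closedBall 0 1, ψ (RelCWComplex.map c.1 c.2 v) = v) ∧
      ∀ x ∈ c.carrier, ψ x ∈ closedBall 0 1 ∧ RelCWComplex.map c.1 c.2 (ψ x) = x := by
  have hl : ∀ v ∈ closedBall 0 1, Function.invFunOn (RelCWComplex.map c.1 c.2) (closedBall 0 1)
      (RelCWComplex.map c.1 c.2 v) = v := fun v hv ↦ (hreg.injOn_map c).leftInvOn_invFunOn hv
  have hr : ∀ x ∈ c.carrier, Function.invFunOn (RelCWComplex.map c.1 c.2) (closedBall 0 1) x ∈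
      closedBall 0 1 ∧ RelCWComplex.map c.1 c.2
        (Function.invFunOn (RelCWComplex.map c.1 c.2) (closedBall 0 1) x) = x := fun x hx ↦
    ⟨Function.invFunOn_mem hx, Function.invFunOn_eq hx⟩
  refine ⟨_, ?_, hl, hr⟩
  rw [continuousOn_iff_continuous_domRestrict]
  have : Continuous fun x : c.carrier ↦
      (⟨Function.invFunOn (RelCWComplex.map c.1 c.2) (closedBall 0 1) x, (hr x x.2).1⟩ :
        closedBall (0 : Fin c.1 → ℝ) 1) := by
    rw [(hreg c.1 c.2).continuous_iff]
    refine continuous_subtype_val.congr fun x ↦ ?_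
    exact (hr x x.2).2.symm
  exact continuous_subtype_val.comp this

theorem IsRegular.embedsInDim_carrier (hreg : IsRegular X) (c : Cell X) :
    EmbedsInDim c.1 c.carrier := by
  obtain ⟨ψ, hψ, -, hr⟩ := hreg.exists_inverse c
  refine EmbedsInDim.of_finrank (by simp) c.isCompact_carrier hψ fun x hx y hy hxy ↦ ?_
  rw [← (hr x hx).2, ← (hr y hy).2, hxy]

variable [T2Space X]

theorem Cell.isClosed_carrier (c : Cell X) : IsClosed c.carrier := c.isCompact_carrier.isClosed

theorem Cell.closure_inner (c : Cell X) : closure c.inner = c.carrier :=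
  RelCWComplex.closure_openCell_eq_closedCell

theorem Cell.isClosed_boundary (c : Cell X) : IsClosed c.boundary :=
  RelCWComplex.isClosed_cellFrontier

variable [RelCWComplex.Finite (univ : Set X)]

theorem isClosed_iUnion_carrier (S : Set (Cell X)) : IsClosed (⋃ c ∈ S, c.carrier) := by
  have : Finite (Cell X) := RelCWComplex.finite_cells_of_finite
  exact (toFinite S).isClosed_biUnion fun c _ ↦ c.isClosed_carrier

/-- The open cells of codimension one are relatively open in the boundary of a cell. -/
theorem Cell.exists_isOpen_mem_iff_map_mem_inner {T e : Cell X} (hdim : e.1 + 1 = T.1) :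
    ∃ N : Set (Fin T.1 → ℝ), IsOpen N ∧
      ∀ v ∈ sphere 0 1, v ∈ N ↔ RelCWComplex.map T.1 T.2 v ∈ e.inner := by
  -- The other closed cells of dimension at most `e.1` miss `e.inner`, and together with it they
  -- cover the boundary of `T`.
  have hZ := isClosed_iUnion_carrier {c : Cell X | c.1 ≤ e.1 ∧ c ≠ e}
  refine ⟨_, (T.continuousOn_map.mono sphere_subset_closedBall).preimage_isClosed_of_isClosed
    isClosed_sphere hZ |>.isOpen_compl, fun v hv ↦ ?_⟩
  simp only [mem_compl_iff, mem_inter_iff, hv, true_and, mem_preimage, mem_iUnion, mem_ofPred_eq]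
  constructor
  · intro h
    obtain ⟨d, hd, hvd⟩ := exists_mem_inner_of_mem_boundary (T.map_mem_boundary hv)
    by_contra hve
    exact h ⟨d, ⟨by omega, fun hde ↦ hve (hde ▸ hvd)⟩, d.inner_subset_carrier hvd⟩
  · rintro hve ⟨c, ⟨hc, hce⟩, hvc⟩
    rcases dim_lt_or_eq hvc hve with h | h
    · omega
    · exact hce h.symm

/-- In a regular complex, a cell of codimension one meeting the boundary of a cell lies in it. -/
theorem IsRegular.inner_subset_boundary (hreg : IsRegular X) {T e : Cell X} (hdim : e.1 + 1 = T.1)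
    (hne : (e.inner ∩ T.boundary).Nonempty) : e.inner ⊆ T.boundary := by
  obtain ⟨N, hN, hNe⟩ := Cell.exists_isOpen_mem_iff_map_mem_inner hdim
  obtain ⟨ψ, hψ, hl, hr⟩ := hreg.exists_inverse e
  have hmap : MapsTo (RelCWComplex.map T.1 T.2) (sphere 0 1 ∩ N) e.carrier := fun v hv ↦
    e.inner_subset_carrier ((hNe v hv.1).1 hv.2)
  -- In the coordinates of `e`, the part of its open cell on the boundary of `T` is open by
  -- invariance of domain on the sphere, and relatively closed; the ball is connected.
  have hopen := isOpen_image_sphere_inter (W := Fin e.1 → ℝ) (by simpa using hdim.symm) hN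
    (h := fun v ↦ ψ (RelCWComplex.map T.1 T.2 v))
    (hψ.comp (T.continuousOn_map.mono fun v hv ↦ sphere_subset_closedBall hv.1) hmap)
    (fun v hv w hw hvw ↦ hreg.injOn_map T (sphere_subset_closedBall hv.1)
      (sphere_subset_closedBall hw.1) (by
        rw [← (hr _ (hmap hv)).2, ← (hr _ (hmap hw)).2]
        exact congrArg _ hvw))
  have himage : (fun v ↦ ψ (RelCWComplex.map T.1 T.2 v)) '' (sphere 0 1 ∩ N) =
      ball 0 1 ∩ RelCWComplex.map e.1 e.2 ⁻¹' T.boundary := by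
    ext w
    constructor
    · rintro ⟨v, hv, rfl⟩
      have hv' := (hNe v hv.1).1 hv.2
      refine ⟨?_, ?_⟩
      · obtain ⟨u, hu, huv⟩ := hv'
        simp only [← huv, hl u (ball_subset_closedBall hu)]
        exact hu
      · rw [mem_preimage, (hr _ (hmap hv)).2]
        exact T.map_mem_boundary hv.1
    · rintro ⟨hw, v, hv, hvw⟩
      refine ⟨v, ⟨hv, (hNe v hv).2 ?_⟩, ?_⟩
      · rw [hvw]; exact e.map_mem_inner hw
      · simp only [hvw, hl w (ball_subset_closedBall hw)]
  rw [himage] at hopen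
  have hclosed : IsClosed (closedBall 0 1 ∩ RelCWComplex.map e.1 e.2 ⁻¹' T.boundary) :=
    e.continuousOn_map.preimage_isClosed_of_isClosed isClosed_closedBall T.isClosed_boundary
  have hsub := (convex_ball (0 : Fin e.1 → ℝ) 1).isPreconnected.subset_of_closure_inter_subset
    hopen (by
      obtain ⟨_, ⟨w, hw, rfl⟩, hx⟩ := hne
      exact ⟨w, hw, hw, hx⟩)
    (fun w hw ↦ ⟨hw.2, (closure_minimal (inter_subset_inter_left _ ball_subset_closedBall)
      hclosed hw.1).2⟩)
  rintro _ ⟨w, hw, rfl⟩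
  exact (hsub hw).2

/-- The boundary of a cell of a regular complex is a union of closed cells of codimension one. -/
theorem IsRegular.exists_facet (hreg : IsRegular X) {T : Cell X} {x : X} (hx : x ∈ T.boundary) :
    ∃ e : Cell X, e.1 + 1 = T.1 ∧ x ∈ e.carrier ∧ e.carrier ⊆ T.boundary := by
  classical
  have : Finite (Cell X) := RelCWComplex.finite_cells_of_finite
  have := Fintype.ofFinite (Cell X)
  by_contra! hno
  obtain ⟨s, hs, rfl⟩ := hx
  -- Points of the sphere not mapped into a facet form a relatively open set covered by cells of
  -- codimension one or more in the sphere, so there are none.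
  have hA := isClosed_iUnion_carrier {e : Cell X | e.1 + 1 = T.1 ∧ e.carrier ⊆ T.boundary}
  have hcl := (T.continuousOn_map.mono sphere_subset_closedBall).preimage_isClosed_of_isClosed
    isClosed_sphere hA
  refine not_sphere_inter_subset_iUnion_embedsInDim hcl.isOpen_compl ⟨s, hs, ?_⟩
    (Finset.univ.filter fun c : Cell X ↦ c.1 + 1 < T.1) (d := fun c ↦ c.1)
    (K := fun c ↦ sphere 0 1 ∩ RelCWComplex.map T.1 T.2 ⁻¹' c.carrier) (fun c hc ↦ ⟨?_, ?_⟩) ?_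
  · rintro ⟨-, h⟩
    obtain ⟨e, ⟨he, heT⟩, hse⟩ := mem_iUnion₂.1 h
    exact hno e he hse heT
  · obtain ⟨ψ, hψ, -, hr⟩ := hreg.exists_inverse c
    have hTc := T.continuousOn_map.mono (sphere_subset_closedBall (x := 0) (ε := 1))
    refine EmbedsInDim.of_finrank (V := Fin c.1 → ℝ) (by simp)
      ((isCompact_sphere 0 1).of_isClosed_subset
        (hTc.preimage_isClosed_of_isClosed isClosed_sphere c.isClosed_carrier) inter_subset_left)
      (hψ.comp (hTc.mono inter_subset_left) fun v hv ↦ hv.2) fun v hv w hw hvw ↦ ?_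
    refine hreg.injOn_map T (sphere_subset_closedBall hv.1) (sphere_subset_closedBall hw.1) ?_
    rw [← (hr _ hv.2).2, ← (hr _ hw.2).2]
    exact congrArg _ hvw
  · simpa using (Finset.mem_filter.1 hc).2
  · rintro v ⟨hv, hvA⟩
    obtain ⟨e, heT, hve⟩ := Cell.exists_mem_inner_of_mem_boundary (T.map_mem_boundary hv)
    refine mem_iUnion₂.2 ⟨e, ?_, hv, e.inner_subset_carrier hve⟩
    rw [Finset.mem_filter]
    refine ⟨Finset.mem_univ _, lt_of_le_of_ne heT fun hdim ↦ hvA ⟨hv, ?_⟩⟩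
    refine mem_iUnion₂.2 ⟨e, ⟨hdim, ?_⟩, e.inner_subset_carrier hve⟩
    rw [← e.closure_inner]
    exact closure_minimal (hreg.inner_subset_boundary hdim ⟨_, hve, T.map_mem_boundary hv⟩)
      T.isClosed_boundary

/-- In a regular complex every closed cell is a union of open cells. -/
theorem IsRegular.carrier_subset_carrier (hreg : IsRegular X) {c T : Cell X} {x : X}
    (hxc : x ∈ c.inner) (hxT : x ∈ T.carrier) : c.carrier ⊆ T.carrier := by
  induction h : T.1 generalizing T with
  | zero =>
    rcases Cell.dim_lt_or_eq hxT hxc with h' | h'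
    · omega
    · rw [h']
  | succ n ih =>
    rcases Cell.mem_boundary_or_mem_inner hxT with hx | hx
    · obtain ⟨e, he, hxe, heT⟩ := hreg.exists_facet hx
      exact (ih hxe (by omega)).trans (heT.trans T.boundary_subset_carrier)
    · rw [Cell.eq_of_mem_inner hxc hx]

end RegularCW

/-! ### Interior points of the image, and comparison of the two boundaries. -/

namespace RegularCW

theorem mem_geometricBoundary_iff {X : Type*} {k : ℕ} {f : X → EuclideanSpace ℝ (Fin k)} {p : X} :
    p ∈ geometricBoundary f ↔ f p ∉ interior (range f) := by
  rw [mem_interior_iff_mem_nhds]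
  constructor
  · intro h hmem
    obtain ⟨y, hy, hy'⟩ := (h _ hmem).2
    exact hy' hy
  · intro h U hU
    refine ⟨⟨f p, mem_of_mem_nhds hU, mem_range_self p⟩, ?_⟩
    by_contra hempty
    refine h (Filter.mem_of_superset hU fun y hy ↦ ?_)
    by_contra hyr
    exact hempty ⟨y, hy, hyr⟩

variable {X : Type*} [TopologicalSpace X] [CWComplex (univ : Set X)]

section Image

variable {W : Type*} [NormedAddCommGroup W] [NormedSpace ℝ W] [FiniteDimensional ℝ W] {f : X → W}

/-- An embedding into Euclidean space is open on the open cells of full dimension. -/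
theorem IsRegular.isOpen_image_inner (hreg : IsRegular X) (hf : Continuous f)
    (hinj : Function.Injective f) {T : Cell X} (hT : T.1 = Module.finrank ℝ W) :
    IsOpen (f '' T.inner) := by
  rw [Cell.inner, RelCWComplex.openCell, ← image_comp]
  exact isOpen_image_of_injOn (by simpa using hT) isOpen_ball
    (hf.comp_continuousOn (T.continuousOn_map.mono ball_subset_closedBall))
    (hinj.comp_injOn ((hreg.injOn_map T).mono ball_subset_closedBall))

/-- Two cells of full dimension glued along a common facet form a neighbourhood of the interior
of this facet. -/
theorem IsRegular.image_inner_subset_interior [T2Space X] [RelCWComplex.Finite (univ : Set X)]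
    (hreg : IsRegular X) (hf : Continuous f) (hinj : Function.Injective f) {e T₁ T₂ : Cell X}
    (hT₁ : T₁.1 = Module.finrank ℝ W) (hT₂ : T₂.1 = Module.finrank ℝ W)
    (he : e.1 + 1 = Module.finrank ℝ W) (hne : T₁ ≠ T₂) (he₁ : e.carrier ⊆ T₁.carrier)
    (he₂ : e.carrier ⊆ T₂.carrier) : f '' e.inner ⊆ interior (range f) := by
  obtain ⟨N, hN, hNe⟩ := Cell.exists_isOpen_mem_iff_map_mem_inner (he.trans hT₁.symm)
  obtain ⟨ψ, hψ, hl, hr⟩ := hreg.exists_inverse T₂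
  set φ₁ := RelCWComplex.map T₁.1 T₁.2
  set φ₂ := RelCWComplex.map T₂.1 T₂.2
  have hψsphere : ∀ x ∈ e.inner, ‖ψ x‖ = 1 := fun x hx ↦ by
    have hx₂ := he₂ (e.inner_subset_carrier hx)
    refine le_antisymm (by simpa using (hr x hx₂).1) (not_lt.1 fun hlt ↦ ?_)
    have := T₂.map_mem_inner (v := ψ x) (by simpa using hlt)
    rw [(hr x hx₂).2] at this
    have := congrArg Sigma.fst (Cell.eq_of_mem_inner hx this)
    omega
  -- The transition from directions on the sphere of `T₁` over `e` to the sphere of `T₂`.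
  set τ : (Fin T₁.1 → ℝ) → Fin T₂.1 → ℝ := fun x ↦ ψ (φ₁ (radial x))
  have hrad : ∀ x ∈ openCone N, φ₁ (radial x) ∈ e.inner := fun x hx ↦
    (hNe _ (radial_mem_of_mem_openCone hx).1).1 hx.2
  have hτ : ∀ x ∈ openCone N, ‖τ x‖ = 1 := fun x hx ↦ hψsphere _ (hrad x hx)
  have hτmap : ∀ x ∈ openCone N, φ₂ (τ x) = φ₁ (radial x) := fun x hx ↦
    (hr _ (he₂ (e.inner_subset_carrier (hrad x hx)))).2
  have hτc : ContinuousOn τ (openCone N) :=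
    (hψ.comp (T₁.continuousOn_map.comp (continuousOn_radial.mono fun x hx ↦ hx.1)
      fun x hx ↦ sphere_subset_closedBall (radial_mem_of_mem_openCone hx).1)
      fun x hx ↦ he₂ (e.inner_subset_carrier (hrad x hx)))
  have hτnorm : ∀ x ∈ openCone N, ‖‖x‖⁻¹ • τ x‖ = ‖x‖⁻¹ := fun x hx ↦ by
    rw [norm_smul, norm_inv, norm_norm, hτ x hx, mul_one]
  -- Inversion of the radius continues `φ₁` across the sphere into `T₂`; on the open cone this is
  -- continuous and injective, so invariance of domain applies to `f ∘ Θ`.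
  set Θ : (Fin T₁.1 → ℝ) → X := fun x ↦ if ‖x‖ ≤ 1 then φ₁ x else φ₂ (‖x‖⁻¹ • τ x)
  have hΘ₁ : ∀ x, ‖x‖ ≤ 1 → Θ x = φ₁ x := fun x hx ↦ if_pos hx
  have hΘ₂ : ∀ x, 1 < ‖x‖ → Θ x = φ₂ (‖x‖⁻¹ • τ x) := fun x hx ↦ if_neg (not_le.2 hx)
  have hΘ₂inner : ∀ x ∈ openCone N, 1 < ‖x‖ → Θ x ∈ T₂.inner := fun x hx hx1 ↦ by
    rw [hΘ₂ x hx1]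
    exact T₂.map_mem_inner (by
      rw [mem_ball_zero_iff, hτnorm x hx]
      exact inv_lt_one_of_one_lt₀ hx1)
  have hcont : ContinuousOn Θ (openCone N) := by
    refine ContinuousOn.if ?_ ?_ ?_
    · rintro x ⟨hx, hx1⟩
      have h1 : ‖x‖ = 1 := frontier_le_subset_eq continuous_norm continuous_const hx1
      rw [h1, inv_one, one_smul, hτmap x hx, radial_of_norm_eq_one h1]
    · refine T₁.continuousOn_map.mono ?_
      rintro x ⟨-, hx1⟩
      rw [(isClosed_le continuous_norm continuous_const).closure_eq] at hx1
      simpa using hx1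
    · refine T₂.continuousOn_map.comp
        ((((continuousOn_id.norm.inv₀ fun x hx ↦ norm_ne_zero_iff.2 hx.1).smul hτc)).mono
          inter_subset_left) ?_
      rintro x ⟨hx, hx1⟩
      simp only [not_le] at hx1
      have h1 : 1 ≤ ‖x‖ := closure_lt_subset_le continuous_const continuous_norm hx1
      change ‖x‖⁻¹ • τ x ∈ _
      rw [mem_closedBall_zero_iff, hτnorm x hx]
      exact inv_le_one_of_one_le₀ h1
  have hcross : ∀ x y, ‖x‖ ≤ 1 → y ∈ openCone N → 1 < ‖y‖ → Θ x ≠ Θ y := by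
    intro x y hx hy hy1 hxy
    have h1 : Θ x ∈ T₁.carrier := by
      rw [hΘ₁ x hx]
      exact T₁.map_mem_carrier (by simpa using hx)
    rcases Cell.dim_lt_or_eq h1 (hxy ▸ hΘ₂inner y hy hy1) with h | h
    · omega
    · exact hne h.symm
  have hΘinj : InjOn Θ (openCone N) := by
    intro x hx y hy hxy
    rcases le_or_gt ‖x‖ 1 with hx1 | hx1 <;> rcases le_or_gt ‖y‖ 1 with hy1 | hy1
    · rw [hΘ₁ x hx1, hΘ₁ y hy1] at hxy
      exact hreg.injOn_map T₁ (by simpa using hx1) (by simpa using hy1) hxy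
    · exact absurd hxy (hcross x y hx1 hy hy1)
    · exact absurd hxy.symm (hcross y x hy1 hx hx1)
    · rw [hΘ₂ x hx1, hΘ₂ y hy1] at hxy
      have h1 := hreg.injOn_map T₂
        (by rw [mem_closedBall_zero_iff, hτnorm x hx]; exact inv_le_one_of_one_le₀ hx1.le)
        (by rw [mem_closedBall_zero_iff, hτnorm y hy]; exact inv_le_one_of_one_le₀ hy1.le) hxy
      have h2 : ‖x‖ = ‖y‖ := by
        have := congrArg norm h1
        rwa [hτnorm x hx, hτnorm y hy, inv_inj] at this
      rw [h2] at h1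
      have h3 : τ x = τ y := smul_right_injective _ (inv_ne_zero (by linarith)) h1
      have h4 : φ₁ (radial x) = φ₁ (radial y) := by rw [← hτmap x hx, ← hτmap y hy, h3]
      have h5 := hreg.injOn_map T₁ (sphere_subset_closedBall (radial_mem_of_mem_openCone hx).1)
        (sphere_subset_closedBall (radial_mem_of_mem_openCone hy).1) h4
      rw [← norm_smul_radial x, ← norm_smul_radial y, h2, h5]
  have hopen := isOpen_image_of_injOn (by simpa using hT₁) (isOpen_openCone hN)
    (hf.comp_continuousOn hcont) (hinj.comp_injOn hΘinj)
  rintro _ ⟨x, hx, rfl⟩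
  refine interior_maximal ?_ hopen ?_
  · rintro _ ⟨v, -, rfl⟩
    exact mem_range_self _
  · obtain ⟨v, hv, hvx⟩ : x ∈ T₁.boundary := by
      rcases Cell.mem_boundary_or_mem_inner (he₁ (e.inner_subset_carrier hx)) with h | h
      · exact h
      · have := congrArg Sigma.fst (Cell.eq_of_mem_inner hx h)
        omega
    refine ⟨v, mem_openCone_of_mem_sphere ⟨hv, (hNe v hv).2 ?_⟩, ?_⟩
    · rw [hvx]
      exact hx
    · change f (Θ v) = f x
      rw [hΘ₁ v (by simpa using (sphere_subset_closedBall hv)), hvx]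

end Image

variable {k : ℕ} {f : X → EuclideanSpace ℝ (Fin k)}

variable [RelCWComplex.Finite (univ : Set X)]

theorem isClosed_image_iUnion_carrier (hf : Continuous f) (S : Set (Cell X)) :
    IsClosed (f '' ⋃ c ∈ S, c.carrier) := by
  have : Finite (Cell X) := RelCWComplex.finite_cells_of_finite
  exact (((toFinite S).isCompact_biUnion fun c _ ↦ c.isCompact_carrier).image hf).isClosed

variable [T2Space X]

/-- An interior point of the image lying in an open cell of positive codimension lies in two
cells of full dimension. -/
theorem IsRegular.not_subsingleton_of_mem_interior (hreg : IsRegular X) (hdim : HasDimension X k)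
    (hf : IsEmbedding f) {c : Cell X} (hck : c.1 < k) {p : X} (hp : p ∈ c.inner)
    (hint : f p ∈ interior (range f)) :
    ¬ {T : Cell X | T.1 = k ∧ c.carrier ⊆ T.carrier}.Subsingleton := by
  classical
  intro hsub
  have : Finite (Cell X) := RelCWComplex.finite_cells_of_finite
  have := Fintype.ofFinite (Cell X)
  have hle : ∀ e : Cell X, e.1 ≤ k := fun e ↦ not_lt.1 fun h ↦ (hdim.2 e.1 h).false e.2
  have hthin : ∀ U : Set (EuclideanSpace ℝ (Fin k)), IsOpen U → U.Nonempty → U ⊆ range f →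
      ∃ e : Cell X, e.1 = k ∧ ∃ x ∈ e.inner, f x ∈ U := by
    intro U hU hne hUr
    by_contra! hno
    refine not_subset_iUnion_embedsInDim hU hne (Finset.univ.filter fun e : Cell X ↦ e.1 < k)
      (K := fun e ↦ f '' e.carrier) (d := fun e ↦ e.1)
      (fun e he ↦ ⟨(hreg.embedsInDim_carrier e).image hf, by simpa using he⟩) fun y hy ↦ ?_
    obtain ⟨x, rfl⟩ := hUr hy
    obtain ⟨e, hxe⟩ := exists_mem_inner x
    refine mem_iUnion₂.2 ⟨e, ?_, mem_image_of_mem f (e.inner_subset_carrier hxe)⟩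
    simpa using (hle e).lt_of_ne fun h ↦ hno e h x hxe hy
  -- By finiteness this is closed; off it, only cells containing `p` occur.
  set M := f '' ⋃ e ∈ {e : Cell X | p ∉ e.carrier}, e.carrier
  have hM : IsClosed M := isClosed_image_iUnion_carrier hf.continuous _
  have hpM : f p ∉ M := by
    rintro ⟨x, hx, hxp⟩
    rw [hf.injective hxp] at hx
    obtain ⟨e, he, hpe⟩ := mem_iUnion₂.1 hx
    exact he hpe
  set B := interior (range f) ∩ Mᶜ
  have hB : IsOpen B := isOpen_interior.inter hM.isOpen_compl
  have hpB : f p ∈ B := ⟨hint, hpM⟩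
  have hmem : ∀ e : Cell X, ∀ x ∈ e.inner, f x ∈ B → p ∈ e.carrier := fun e x hx hxB ↦ by
    by_contra hpe
    exact hxB.2 ⟨x, mem_iUnion₂.2 ⟨e, hpe, e.inner_subset_carrier hx⟩, rfl⟩
  obtain ⟨T, hTk, x, hxT, hxB⟩ := hthin B hB ⟨_, hpB⟩ fun y hy ↦ interior_subset hy.1
  have hpT := hmem T x hxT hxB
  -- An open remainder would meet another open `k`-cell, which contains `p`, hence `c`, hence equals
  -- `T`.
  have hBT : B ⊆ f '' T.carrier := by
    by_contra hnot
    obtain ⟨y, hyB, hyT⟩ := not_subset.1 hnot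
    obtain ⟨e, hek, z, hze, hz⟩ := hthin (B ∩ (f '' T.carrier)ᶜ)
      (hB.inter (T.isCompact_carrier.image hf.continuous).isClosed.isOpen_compl) ⟨y, hyB, hyT⟩
      fun y hy ↦ interior_subset hy.1.1
    have hpe := hmem e z hze hz.1
    have heT : e = T := hsub ⟨hek, hreg.carrier_subset_carrier hp hpe⟩
      ⟨hTk, hreg.carrier_subset_carrier hp hpT⟩
    exact hz.2 ⟨z, heT ▸ e.inner_subset_carrier hze, rfl⟩
  obtain ⟨ψ, hψ, -, hr⟩ := hreg.exists_inverse T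
  have : Nonempty X := ⟨p⟩
  have hinv := Function.leftInverse_invFun hf.injective
  have hinvT : MapsTo (Function.invFun f) B T.carrier := fun y hy ↦ by
    obtain ⟨x, hx, rfl⟩ := hBT hy
    rwa [hinv x]
  -- In the coordinates of `T`, `B` becomes an open subset of the closed ball, hence of the open
  -- ball, which places `p` in `T.inner`.
  have hopen := isOpen_image_of_injOn (W := Fin T.1 → ℝ) (by simpa using hTk.symm) hB
    (f := fun y ↦ ψ (Function.invFun f y))
    (hψ.comp (hf.continuousOn_invFun.mono fun y hy ↦ interior_subset hy.1) hinvT)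
    (fun y hy z hz hyz ↦ by
      have h1 : Function.invFun f y = Function.invFun f z := by
        rw [← (hr _ (hinvT hy)).2, ← (hr _ (hinvT hz)).2]
        exact congrArg _ hyz
      obtain ⟨y, -, rfl⟩ := hBT hy
      obtain ⟨z, -, rfl⟩ := hBT hz
      rw [hinv, hinv] at h1
      rw [h1])
  have hball := interior_maximal (s := closedBall 0 1)
    (by rintro _ ⟨y, hy, rfl⟩; exact (hr _ (hinvT hy)).1) hopen ⟨f p, hpB, rfl⟩
  rw [interior_closedBall _ one_ne_zero] at hball
  simp only [hinv p] at hball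
  have hpTi := T.map_mem_inner hball
  rw [(hr p hpT).2] at hpTi
  have := congrArg Sigma.fst (Cell.eq_of_mem_inner hp hpTi)
  omega

/-- A point all of whose cells of positive codimension lie in two cells of full dimension is
mapped into the interior of the image. -/
theorem IsRegular.mem_interior_of_forall_not_subsingleton (hreg : IsRegular X)
    (hdim : HasDimension X k) (hf : IsEmbedding f) {p : X}
    (hp : ∀ c : Cell X, c.1 < k → p ∈ c.carrier →
      ¬ {T : Cell X | T.1 = k ∧ c.carrier ⊆ T.carrier}.Subsingleton) :
    f p ∈ interior (range f) := by
  classical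
  by_contra hnot
  have : Finite (Cell X) := RelCWComplex.finite_cells_of_finite
  have := Fintype.ofFinite (Cell X)
  have hle : ∀ e : Cell X, e.1 ≤ k := fun e ↦ not_lt.1 fun h ↦ (hdim.2 e.1 h).false e.2
  have hclosed : IsClosed (range f) := by
    have h1 := isClosed_image_iUnion_carrier hf.continuous (univ : Set (Cell X))
    have h2 : ⋃ c ∈ (univ : Set (Cell X)), c.carrier = univ := eq_univ_of_forall fun x ↦ by
      obtain ⟨c, hc⟩ := exists_mem_inner x
      exact mem_iUnion₂.2 ⟨c, mem_univ c, c.inner_subset_carrier hc⟩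
    rwa [h2, image_univ] at h1
  have htop : ∀ T : Cell X, T.1 = k → f '' T.inner ⊆ interior (range f) := fun T hT ↦
    interior_maximal (image_subset_range f _)
      (hreg.isOpen_image_inner hf.continuous hf.injective (by simpa using hT))
  set M := f '' ⋃ e ∈ {e : Cell X | p ∉ e.carrier}, e.carrier
  have hM : IsClosed M := isClosed_image_iUnion_carrier hf.continuous _
  have hpM : f p ∈ Mᶜ := by
    rintro ⟨x, hx, hxp⟩
    rw [hf.injective hxp] at hx
    obtain ⟨e, he, hpe⟩ := mem_iUnion₂.1 hx
    exact he hpe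
  obtain ⟨r, hr, hrM⟩ := Metric.isOpen_iff.1 hM.isOpen_compl _ hpM
  obtain ⟨T, hTk, hpT⟩ : ∃ T : Cell X, T.1 = k ∧ p ∈ T.carrier := by
    obtain ⟨c, hc⟩ := exists_mem_inner p
    have hpc := c.inner_subset_carrier hc
    rcases (hle c).lt_or_eq with h | h
    · obtain ⟨T, hT, -⟩ := not_subsingleton_iff.1 (hp c h hpc)
      exact ⟨T, hT.1, hT.2 hpc⟩
    · exact ⟨c, h, hpc⟩
  -- `G` is nonempty because `p` is a limit of `T.inner`; `H` is nonempty because `f p` is not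
  -- interior.
  refine not_separated_by_codim_two (convex_ball (f p) r)
    (G := ball (f p) r ∩ interior (range f)) (H := ball (f p) r ∩ (range f)ᶜ)
    (isOpen_ball.inter isOpen_interior) (isOpen_ball.inter hclosed.isOpen_compl)
    inter_subset_left inter_subset_left ?_ ?_ ?_
    (Finset.univ.filter fun e : Cell X ↦ e.1 + 1 < k)
    (K := fun e ↦ f '' e.carrier) (d := fun e ↦ e.1)
    (fun e he ↦ ⟨(hreg.embedsInDim_carrier e).image hf, by simpa using he⟩) ?_
  · exact Set.disjoint_left.2 fun y hy hy' ↦ hy'.2 (interior_subset hy.2)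
  · rw [← T.closure_inner] at hpT
    obtain ⟨q, hq, hqT⟩ := mem_closure_iff.1 hpT _ (isOpen_ball.preimage hf.continuous)
      (mem_ball_self hr)
    exact ⟨f q, hq, htop T hTk (mem_image_of_mem f hqT)⟩
  · by_contra hempty
    refine hnot (interior_maximal (fun y hy ↦ ?_) isOpen_ball (mem_ball_self hr))
    by_contra hyr
    exact hempty ⟨y, hy, hyr⟩
  · intro y hy
    by_cases hyr : y ∈ range f
    · obtain ⟨x, rfl⟩ := hyr
      obtain ⟨e, hxe⟩ := exists_mem_inner x
      have hpe : p ∈ e.carrier := by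
        by_contra hpe
        exact hrM hy ⟨x, mem_iUnion₂.2 ⟨e, hpe, e.inner_subset_carrier hxe⟩, rfl⟩
      rcases lt_or_ge (e.1 + 1) k with h | h
      · exact Or.inr (mem_iUnion₂.2 ⟨e, by simpa using h,
          mem_image_of_mem f (e.inner_subset_carrier hxe)⟩)
      · refine Or.inl (Or.inl ⟨hy, ?_⟩)
        rcases (hle e).lt_or_eq with h' | h'
        · obtain ⟨T₁, hT₁, T₂, hT₂, hne⟩ := not_subsingleton_iff.1 (hp e h' hpe)
          exact hreg.image_inner_subset_interior hf.continuous hf.injective (by simpa using hT₁.1)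
            (by simpa using hT₂.1) (by rw [finrank_euclideanSpace_fin]; omega) hne hT₁.2 hT₂.2
            (mem_image_of_mem f hxe)
        · exact htop e h' (mem_image_of_mem f hxe)
    · exact Or.inl (Or.inr ⟨hy, hyr⟩)

theorem IsRegular.geometricBoundary_eq (hreg : IsRegular X) (hdim : HasDimension X k)
    (hf : IsEmbedding f) : geometricBoundary f = combinatorialBoundary X k := by
  ext p
  rw [mem_geometricBoundary_iff]
  constructor
  · intro hnot
    by_contra hpb
    refine hnot (hreg.mem_interior_of_forall_not_subsingleton hdim hf fun c hck hpc hsub ↦ hpb ?_)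
    exact mem_iUnion₂.2 ⟨c, ⟨c, ⟨hck, hsub⟩, Subset.rfl⟩, hpc⟩
  · intro hpb hint
    obtain ⟨c, ⟨d, ⟨hdk, hsub⟩, hcd⟩, hpc⟩ := mem_iUnion₂.1 hpb
    have hpd := hcd hpc
    rw [← d.closure_inner] at hpd
    -- `p` may lie in a proper face of `d`; density of `d.inner` moves it to a point whose own cell
    -- is `d`.
    obtain ⟨q, hq, hqd⟩ := mem_closure_iff.1 hpd _ (isOpen_interior.preimage hf.continuous) hint
    exact hreg.not_subsingleton_of_mem_interior hdim hf hdk hqd hq hsub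

end RegularCW

theorem proposition2p1 {X : Type*} [TopologicalSpace X] [T2Space X]
    [CWComplex (univ : Set X)] [RelCWComplex.Finite (univ : Set X)]
    (hreg : RegularCW.IsRegular X) (k : ℕ) (hdim : RegularCW.HasDimension X k) :
    (∀ f : X → EuclideanSpace ℝ (Fin k), IsEmbedding f →
      RegularCW.geometricBoundary f = RegularCW.combinatorialBoundary X k) ∧
    (∀ f g : X → EuclideanSpace ℝ (Fin k), IsEmbedding f → IsEmbedding g →
      RegularCW.geometricBoundary f = RegularCW.geometricBoundary g) := by
  refine ⟨fun f hf ↦ hreg.geometricBoundary_eq hdim hf, fun f g hf hg ↦ ?_⟩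
  rw [hreg.geometricBoundary_eq hdim hf, hreg.geometricBoundary_eq hdim hg]
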